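/- For $d\ge 1$ let $|\cdot|$ be the Euclidean norm on $\mathbf R^d$. A cube of side length $r$ centered at $x$ is the closed axis-parallel cube $I=\{y:\max_i|y_i-x_i|\le r/2\}$, and $I\cdot 2$ is the cube of side length $2r$ with the same center. For $0<h\le 1$, a Borel measure $\mu$ on $\mathbf R^d$ is doubling on scales $[h,1]$ with constant $C_D>0$ if $\mu(I\cdot 2)\le C_D\,\mu(I)$ for every cube $I$ of side length $r\in[h,\tfrac12]$ centered at a point of $\operatorname{supp}\mu$. For sets $X,Y\subseteq\mathbf R^d$ and a real function $\Phi$ defined at least on $X\times Y$, the pair $(X,Y)$ is $\Phi$-nonorthogonal with constant $0<c_N\le 1$ from scales $h$ to $1$ if for all $x_0\in X$, $y_0\in Y$ and $r_X,r_Y\in(h,1)$ there are $x_1,x_2\in X$ with $|x_i-x_0|<r_X$ and $y_1,y_2\in Y$ with $|y_i-y_0|<r_Y$ such that $$|\Phi(x_1,y_1)-\Phi(x_2,y_1)-\Phi(x_1,y_2)+\Phi(x_2,y_2)|\ge c_N\,r_X r_Y .$$ For a function $g$ on a compact set put $\|g\|_{C^1}=\sup|g|+\sup|\nabla g|$. Here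 $|\partial^2_{xy}\Phi|$ is the norm of the bilinear form $(v,w)\mapsto\partial_v\partial_w\Phi$ on $\mathbf R^d_x\times\mathbf R^d_y$ (the supremum over unit vectors $v,w$), and gradients on $\mathbf R^d\times\mathbf R^d=\mathbf R^{2d}$ are measured by their operator norm with respect to the Euclidean norm. **Theorem.** Let $d\ge1$, $0<c_N\le 1$, $A\in\mathbf R$ and $C_X,C_Y>0$, and put $$L:=\frac{10^{14}d^3}{c_N^3}\max(1,A^3).$$ There are $\varepsilon_0>0$ with $$\frac1{\varepsilon_0}\le 6\cdot 10^9\,c_N^{-2}d^2\,(C_XC_Y)^{4\lceil\log_2(20L^{5/3})\rceil}L^{2/3}\log L$$ and $C>0$, both depending only on $d,c_N,A,C_X,C_Y$, such that the following holds. Let $0<h\le1$, let $I_0,J_0\subset\mathbf R^d$ be closed axis-parallel cubes of side length $1$, and let $\mu_X,\mu_Y$ be Borel probability measures on $\mathbf R^d$ with supports $X\subseteq I_0$ and $Y\subseteq J_0$ that are doubling on scales $[h,1]$ with constants $C_X$ and $C_Y$ respectively. Let $\Phi\in C^3(I_0\times J_0;\mathbf R)$ with $\|\partial^2_{xy}\Phi\|_{C^1(I_0\times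 J_0)}\le A$, let $p\in C^1(I_0\times J_0;\mathbf C)$, and suppose that $(X,Y)$ is $\Phi$-nonorthogonal with constant $c_N$ from scales $h$ to $1$. Then the operator $$\mathcal B_hf(x)=\int_Y e^{i\Phi(x,y)/h}\,p(x,y)f(y)\,d\mu_Y(y)$$ is bounded from $L^2(\mu_Y)$ to $L^2(\mu_X)$, and $$\|\mathcal B_h\|_{L^2(\mu_Y)\to L^2(\mu_X)}\le C\,\|p\|_{C^1(I_0\times J_0)}\,h^{\varepsilon_0}.$$ -/

import Mathlib

open MeasureTheory Set

noncomputable section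

/-- `d`-dimensional Euclidean space. -/
abbrev Euc (d : ℕ) : Type := EuclideanSpace ℝ (Fin d)

/-- The closed axis-parallel box of unit side length with lower corner `a`. -/
def unitBox {d : ℕ} (a : Euc d) : Set (Euc d) :=
  {x | ∀ i, x i ∈ Set.Icc (a i) (a i + 1)}

/-- The closed axis-parallel cube of side length `r` centered at `x`. Its dilate by the factor `2`
about its center is `cube x (2 * r)`. -/
def cube {d : ℕ} (x : Euc d) (r : ℝ) : Set (Euc d) :=
  {y | ∀ i, |y i - x i| ≤ r / 2}

/-- `μ` is doubling on scales `[h, 1]` with doubling constant `C`: doubling a cube of side length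
`r ∈ [h, 1/2]` centered at a point of the support of `μ` multiplies its mass by at most `C`. -/
def IsDoubling {d : ℕ} (μ : Measure (Euc d)) (h C : ℝ) : Prop :=
  0 < C ∧ ∀ r ∈ Set.Icc h (1 / 2 : ℝ), ∀ x ∈ μ.support,
    μ (cube x (2 * r)) ≤ ENNReal.ofReal C * μ (cube x r)

/-- `(X, Y)` is `Φ`-nonorthogonal with constant `c` from scales `(αX, αY)` to `(βX, βY)`. Balls are
open Euclidean balls. -/
def IsNonorthogonal {d : ℕ} (Φ : Euc d × Euc d → ℝ) (X Y : Set (Euc d))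
    (c αX αY βX βY : ℝ) : Prop :=
  0 < c ∧ c ≤ 1 ∧
    ∀ x₀ ∈ X, ∀ y₀ ∈ Y, ∀ rX ∈ Set.Ioo αX βX, ∀ rY ∈ Set.Ioo αY βY,
      ∃ x₁ ∈ X ∩ Metric.ball x₀ rX, ∃ x₂ ∈ X ∩ Metric.ball x₀ rX,
      ∃ y₁ ∈ Y ∩ Metric.ball y₀ rY, ∃ y₂ ∈ Y ∩ Metric.ball y₀ rY,
        c * rX * rY ≤ |Φ (x₁, y₁) - Φ (x₂, y₁) - Φ (x₁, y₂) + Φ (x₂, y₂)|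

/-- The supremum norm on `S` (meant for continuous functions on nonempty compact sets). -/
def c0Norm {α F : Type*} [NormedAddCommGroup F] (S : Set α) (g : α → F) : ℝ :=
  ⨆ z : S, ‖g z‖

/-- The `C¹` norm `‖g‖_{C⁰(S)} + ‖∇g‖_{C⁰(S)}` of a function on `S ⊆ ℝᵈ × ℝᵈ`. Lean's product
carries the maximum norm, so the derivative is precomposed with the identification of the
Euclidean space `ℝᵈ × ℝᵈ = ℝ²ᵈ` with it; the length of the derivative is thus its operator norm
with respect to the Euclidean norm of `ℝ²ᵈ`. -/
def c1Norm {d : ℕ} {F : Type*} [NormedAddCommGroup F] [NormedSpace ℝ F]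
    (S : Set (Euc d × Euc d)) (g : Euc d × Euc d → F) : ℝ :=
  c0Norm S g + c0Norm S (fun z => (fderivWithin ℝ g S z).comp
    (WithLp.prodContinuousLinearEquiv 2 ℝ (Euc d) (Euc d)).toContinuousLinearMap)

/-- The off-diagonal Hessian `∂²_{xy} Φ` on `S`: at the point `z` it is the bilinear form
`(v, w) ↦ ∂_v ∂_w Φ (z)`, with `v` in the `x`-directions and `w` in the `y`-directions. -/
def mixedHessian {d : ℕ} (S : Set (Euc d × Euc d)) (Φ : Euc d × Euc d → ℝ)
    (z : Euc d × Euc d) : Euc d →L[ℝ] Euc d →L[ℝ] ℝ :=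
  (fderivWithin ℝ (fderivWithin ℝ Φ S) S z).bilinearComp
    (ContinuousLinearMap.inl ℝ (Euc d) (Euc d)) (ContinuousLinearMap.inr ℝ (Euc d) (Euc d))

/-- The semiclassical Fourier integral operator with phase `Φ` and symbol `p`,
`B_h f (x) = ∫_Y exp (i Φ(x, y) / h) p(x, y) f(y) dμ(y)`, where `Y = supp μ`. -/
def semiclassicalFIO {d : ℕ} (Φ : Euc d × Euc d → ℝ) (p : Euc d × Euc d → ℂ) (h : ℝ)
    (μ : Measure (Euc d)) (f : Euc d → ℂ) (x : Euc d) : ℂ :=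
  ∫ y in μ.support, Complex.exp (Complex.I * ((Φ (x, y) / h : ℝ) : ℂ)) * p (x, y) * f y ∂μ

/-- `L = 10¹⁴ d³ c⁻³ max(1, A³)`. -/
def baseL (d : ℕ) (c A : ℝ) : ℝ :=
  10 ^ 14 * (d : ℝ) ^ 3 / c ^ 3 * max 1 (A ^ 3)

/-- The upper bound
`6 · 10⁹ c⁻² d² (C_X C_Y) ^ (4 ⌈log₂ (20 L^{5/3})⌉) L^{2/3} log L` for `1 / ε₀`. -/
def invExponentBound (d : ℕ) (c A CX CY : ℝ) : ℝ :=
  6 * 10 ^ 9 / c ^ 2 * (d : ℝ) ^ 2 *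
    (CX * CY) ^ (4 * ⌈Real.logb 2 (20 * baseL d c A ^ (5 / 3 : ℝ))⌉₊) *
    baseL d c A ^ (2 / 3 : ℝ) * Real.log (baseL d c A)

end

/-!
The proof is Dolgopyat's method, run with Lipschitz seminorms on cells of nested partitions.

Put `L = baseL d c A`. Each support carries nested partitions into cells of diameter about `s L ^ j`
(`NetTower`), and every cell contains all points of the support in a ball of comparable radius. A
cell `I` of the `x`-partition at scale `ρ` is paired with a cell `J` of the `y`-partition at scale
`h / ρ`. The average `F_J` over `J` of the integrand, with the phase normalized to vanish at the
center of `J` (`cellAverage`), then varies on `I` at the natural rate `1 / ρ`: up to constants it is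
controlled by a single number `R(I, J)` that bounds `|F_J|` and `ρ` times its Lipschitz constant
(`IsTame`). Of `Φ` this uses only that the mixed second difference is at most
`A |x - x'| |y - y'|`, which is the bound on the mixed Hessian (`abs_mixed_difference_le`).

The energy `∑ μX(I) μY(J) R(I, J)²` at the initial pair of scales, about `(1, h)`, is at most
`‖p‖²_{C¹} ‖f‖²`, and at the final pair, about `(h, 1)`, it dominates `‖B_h f‖²`. Passing from `ρ`
to `ρ / L` replaces `F_J` by an average of the amplitudes of the subcells of `J`, modulated by
phases. Convexity shows that the energy does not increase. If it hardly decreased, then any two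
modulated amplitudes of substantial weight would be nearly equal at some point of each subcell of
`I` of substantial mass, since a lack of alignment shows up in the variance. Nonorthogonality
supplies two subcells of `I` and two of `J` at which the mixed difference of the phases is too large
for that, yet too small to wrap around the circle (`exists_separated_phases`,
`exists_isTame_average_contraction`). By the doubling property these subcells carry at least the
fractions `C_X ^ (-N)` and `C_Y ^ (-N)` of the mass of `I` and `J`, with `2 ^ N` of size
`L ^ (5 / 3)`, so each step loses a fixed fraction of the energy (`HasEnergyBound.step`). There are
about `log (1 / h) / log L` steps, which gives the power of `h`. For `h` bounded below the trivial
bound suffices; this also covers doubling constants below `1`, which occur only when `h > 1 / 2`.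
-/

noncomputable section

/-! ### Averages of tame functions with oscillating weights -/

/-- `F` is bounded by `R` and Lipschitz with constant `R * κ` on `I`. With `κ` inversely
proportional to the diameter of `I`, the least such `R` is the scale-invariant Lipschitz norm in
which the contraction takes place. -/
def IsTame {E : Type*} [PseudoMetricSpace E] (F : E → ℂ) (I : Set E) (κ R : ℝ) : Prop :=
  (∀ x ∈ I, ‖F x‖ ≤ R) ∧ ∀ x ∈ I, ∀ x' ∈ I, ‖F x - F x'‖ ≤ R * κ * dist x x'

lemma norm_exp_I_mul_ofReal (t : ℝ) : ‖Complex.exp (Complex.I * (t : ℂ))‖ = 1 := by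
  rw [mul_comm]; exact Complex.norm_exp_ofReal_mul_I t

lemma norm_exp_sub_exp (s t : ℝ) :
    ‖Complex.exp (Complex.I * (s : ℂ)) - Complex.exp (Complex.I * (t : ℂ))‖ =
      ‖Complex.exp (Complex.I * ((s - t : ℝ) : ℂ)) - 1‖ := by
  have h : Complex.exp (Complex.I * (s : ℂ)) - Complex.exp (Complex.I * (t : ℂ)) =
      Complex.exp (Complex.I * (t : ℂ)) * (Complex.exp (Complex.I * ((s - t : ℝ) : ℂ)) - 1) := by
    rw [mul_sub, ← Complex.exp_add, mul_one]
    congr 2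
    push_cast
    ring
  rw [h, norm_mul, norm_exp_I_mul_ofReal, one_mul]

lemma norm_exp_sub_exp_le (s t : ℝ) :
    ‖Complex.exp (Complex.I * (s : ℂ)) - Complex.exp (Complex.I * (t : ℂ))‖ ≤ |s - t| := by
  rw [norm_exp_sub_exp, ← Real.norm_eq_abs]
  exact Real.norm_exp_I_mul_ofReal_sub_one_le

lemma half_abs_le_norm_exp_sub_exp {s t : ℝ} (hst : |s - t| ≤ 1) :
    |s - t| / 2 ≤ ‖Complex.exp (Complex.I * (s : ℂ)) - Complex.exp (Complex.I * (t : ℂ))‖ := by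
  rw [norm_exp_sub_exp, Complex.norm_exp_I_mul_ofReal_sub_one,
    norm_mul, Real.norm_eq_abs, Real.norm_eq_abs, abs_of_pos (two_pos : (0 : ℝ) < 2)]
  have h1 := Real.mul_abs_le_abs_sin (x := (s - t) / 2) (by
    rw [abs_div, abs_of_pos (two_pos : (0 : ℝ) < 2)]
    linarith [Real.pi_gt_three])
  rw [abs_div, abs_of_pos (two_pos : (0 : ℝ) < 2)] at h1
  have h2 : (1 / 2 : ℝ) ≤ 2 / Real.pi := by
    rw [div_le_div_iff₀ two_pos Real.pi_pos]
    linarith [Real.pi_le_four]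
  have h3 := mul_le_mul_of_nonneg_right h2 (div_nonneg (abs_nonneg (s - t)) two_pos.le)
  linarith

/-- A weighted average falls short of the average of the squares by at least the contribution of
each single term to the variance. -/
lemma norm_sq_sum_add_le {β : Type*} {t : Finset β} {w R : β → ℝ} {z : β → ℂ}
    (hw : ∀ b ∈ t, 0 ≤ w b) (hw1 : ∑ b ∈ t, w b = 1) (hz : ∀ b ∈ t, ‖z b‖ ≤ R b)
    {b : β} (hb : b ∈ t) :
    ‖∑ b ∈ t, (w b : ℂ) * z b‖ ^ 2 +
        w b * (‖z b - ∑ b ∈ t, (w b : ℂ) * z b‖ ^ 2 + (R b ^ 2 - ‖z b‖ ^ 2)) ≤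
      ∑ b ∈ t, w b * R b ^ 2 := by
  set G := ∑ b ∈ t, (w b : ℂ) * z b with hG
  have hexp : ∀ c : β, ‖z c - G‖ ^ 2 = ‖z c‖ ^ 2 - 2 * (z c * (starRingEnd ℂ) G).re + ‖G‖ ^ 2 := by
    intro c
    rw [← Complex.normSq_eq_norm_sq, ← Complex.normSq_eq_norm_sq, ← Complex.normSq_eq_norm_sq,
      Complex.normSq_sub]
    ring
  have hcross : ∑ c ∈ t, w c * (z c * (starRingEnd ℂ) G).re = ‖G‖ ^ 2 := by
    have : ∑ c ∈ t, w c * (z c * (starRingEnd ℂ) G).re = (G * (starRingEnd ℂ) G).re := by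
      conv_rhs => rw [hG, Finset.sum_mul, Complex.re_sum]
      refine Finset.sum_congr rfl fun c _ => ?_
      rw [mul_assoc, Complex.re_ofReal_mul]
    rw [this, Complex.mul_conj, Complex.ofReal_re, Complex.normSq_eq_norm_sq]
  have htotal : ∑ c ∈ t, w c * (‖z c - G‖ ^ 2 + (R c ^ 2 - ‖z c‖ ^ 2)) =
      ∑ c ∈ t, w c * R c ^ 2 - ‖G‖ ^ 2 := by
    have : ∀ c ∈ t, w c * (‖z c - G‖ ^ 2 + (R c ^ 2 - ‖z c‖ ^ 2)) =
        w c * R c ^ 2 - 2 * (w c * (z c * (starRingEnd ℂ) G).re) + w c * ‖G‖ ^ 2 := by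
      intro c _
      rw [hexp]
      ring
    rw [Finset.sum_congr rfl this, Finset.sum_add_distrib, Finset.sum_sub_distrib,
      ← Finset.mul_sum, hcross, ← Finset.sum_mul, hw1]
    ring
  have hsingle := Finset.single_le_sum
    (f := fun c => w c * (‖z c - G‖ ^ 2 + (R c ^ 2 - ‖z c‖ ^ 2))) (s := t) (fun c hc => by
      refine mul_nonneg (hw c hc) (add_nonneg (sq_nonneg _) (sub_nonneg.2 ?_))
      exact pow_le_pow_left₀ (norm_nonneg _) (hz c hc) 2) hb
  linarith

/-- Alignment of two oscillating terms at two points forces the mixed phase difference to be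
small: `u₁, u₂` and `v₁, v₂` are the values of two amplitudes at the first and the second point. -/
lemma abs_phase_le_of_aligned {u₁ u₂ v₁ v₂ : ℂ} {a₁ a₂ b₁ b₂ s δ e : ℝ}
    (hs : 0 < s) (hv : s / 2 ≤ ‖u₂‖)
    (h1 : ‖Complex.exp (Complex.I * (a₁ : ℂ)) * u₁ - Complex.exp (Complex.I * (a₂ : ℂ)) * u₂‖
      ≤ δ * s)
    (h2 : ‖Complex.exp (Complex.I * (b₁ : ℂ)) * v₁ - Complex.exp (Complex.I * (b₂ : ℂ)) * v₂‖
      ≤ δ * s)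
    (huv : ‖u₁ - v₁‖ + ‖u₂ - v₂‖ ≤ e * s) (hα : |a₁ - a₂ - b₁ + b₂| ≤ 1) :
    |a₁ - a₂ - b₁ + b₂| ≤ 4 * (2 * δ + e) := by
  have key : (Complex.exp (Complex.I * ((b₂ - b₁ : ℝ) : ℂ)) -
      Complex.exp (Complex.I * ((a₂ - a₁ : ℝ) : ℂ))) * u₂ =
      Complex.exp (Complex.I * ((-a₁ : ℝ) : ℂ)) *
        (Complex.exp (Complex.I * (a₁ : ℂ)) * u₁ - Complex.exp (Complex.I * (a₂ : ℂ)) * u₂) -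
      Complex.exp (Complex.I * ((-b₁ : ℝ) : ℂ)) *
        (Complex.exp (Complex.I * (b₁ : ℂ)) * v₁ - Complex.exp (Complex.I * (b₂ : ℂ)) * v₂) -
      (u₁ - v₁) + Complex.exp (Complex.I * ((b₂ - b₁ : ℝ) : ℂ)) * (u₂ - v₂) := by
    have e1 : Complex.exp (Complex.I * ((b₂ - b₁ : ℝ) : ℂ)) =
        Complex.exp (Complex.I * ((-b₁ : ℝ) : ℂ)) * Complex.exp (Complex.I * (b₂ : ℂ)) := by
      rw [← Complex.exp_add]; congr 1; push_cast; ring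
    have e2 : Complex.exp (Complex.I * ((a₂ - a₁ : ℝ) : ℂ)) =
        Complex.exp (Complex.I * ((-a₁ : ℝ) : ℂ)) * Complex.exp (Complex.I * (a₂ : ℂ)) := by
      rw [← Complex.exp_add]; congr 1; push_cast; ring
    have e3 : ∀ r : ℝ, Complex.exp (Complex.I * ((-r : ℝ) : ℂ)) *
        Complex.exp (Complex.I * (r : ℂ)) = 1 := by
      intro r
      rw [← Complex.exp_add]; push_cast; rw [← mul_add]; simp
    rw [e1, e2]
    linear_combination (-u₁) * e3 a₁ + v₁ * e3 b₁
  have hn := congrArg norm key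
  rw [norm_mul] at hn
  have hle : ‖Complex.exp (Complex.I * ((-a₁ : ℝ) : ℂ)) *
        (Complex.exp (Complex.I * (a₁ : ℂ)) * u₁ - Complex.exp (Complex.I * (a₂ : ℂ)) * u₂) -
      Complex.exp (Complex.I * ((-b₁ : ℝ) : ℂ)) *
        (Complex.exp (Complex.I * (b₁ : ℂ)) * v₁ - Complex.exp (Complex.I * (b₂ : ℂ)) * v₂) -
      (u₁ - v₁) + Complex.exp (Complex.I * ((b₂ - b₁ : ℝ) : ℂ)) * (u₂ - v₂)‖ ≤
      δ * s + δ * s + (‖u₁ - v₁‖ + ‖u₂ - v₂‖) := by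
    refine (norm_add_le _ _).trans ?_
    have := (norm_sub_le (Complex.exp (Complex.I * ((-a₁ : ℝ) : ℂ)) *
        (Complex.exp (Complex.I * (a₁ : ℂ)) * u₁ - Complex.exp (Complex.I * (a₂ : ℂ)) * u₂) -
      Complex.exp (Complex.I * ((-b₁ : ℝ) : ℂ)) *
        (Complex.exp (Complex.I * (b₁ : ℂ)) * v₁ - Complex.exp (Complex.I * (b₂ : ℂ)) * v₂))
      (u₁ - v₁)).trans (add_le_add_left (norm_sub_le _ _) _)
    rw [norm_mul, norm_mul, norm_exp_I_mul_ofReal, norm_exp_I_mul_ofReal, one_mul, one_mul] at this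
    rw [norm_mul, norm_exp_I_mul_ofReal, one_mul]
    linarith
  have heq : b₂ - b₁ - (a₂ - a₁) = a₁ - a₂ - b₁ + b₂ := by ring
  have hlow := half_abs_le_norm_exp_sub_exp (s := b₂ - b₁) (t := a₂ - a₁) (by rwa [heq])
  rw [heq] at hlow
  have hmul : |a₁ - a₂ - b₁ + b₂| / 2 * (s / 2) ≤ (2 * δ + e) * s := by
    refine (mul_le_mul hlow hv (by positivity) (norm_nonneg _)).trans ?_
    rw [hn]
    linarith
  have : |a₁ - a₂ - b₁ + b₂| / 4 * s ≤ (2 * δ + e) * s := by linarith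
  have := le_of_mul_le_mul_right this hs
  linarith

/-- If an average of modulated amplitudes nearly attains the quadratic mean `√S` of the bounds at a
point, each amplitude of substantial weight is comparable with `√S` and aligned with the average. -/
lemma aligned_of_norm_sq_gt {β : Type*} {t : Finset β} {w R : β → ℝ} {z : β → ℂ}
    (hw : ∀ b ∈ t, 0 ≤ w b) (hw1 : ∑ b ∈ t, w b = 1) (hz : ∀ b ∈ t, ‖z b‖ ≤ R b)
    {s τ w₀ : ℝ} (hs : 0 ≤ s) (hS : ∑ b ∈ t, w b * R b ^ 2 = s ^ 2) (hτ0 : 0 ≤ τ)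
    (hτ : τ ≤ 1 / 4) (hw0 : 0 < w₀) (hw0' : w₀ ≤ 1)
    (hG : (1 - w₀ * τ ^ 2) * s ^ 2 < ‖∑ b ∈ t, (w b : ℂ) * z b‖ ^ 2)
    {b : β} (hb : b ∈ t) (hwb : w₀ ≤ w b) :
    ‖z b - ∑ b ∈ t, (w b : ℂ) * z b‖ ≤ τ * s ∧ s / 2 ≤ ‖z b‖ ∧ R b ≤ 2 * s := by
  have hv := norm_sq_sum_add_le hw hw1 hz hb
  set G := ∑ b ∈ t, (w b : ℂ) * z b with hGdef
  rw [hS] at hv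
  have hR : 0 ≤ R b ^ 2 - ‖z b‖ ^ 2 :=
    sub_nonneg.2 (pow_le_pow_left₀ (norm_nonneg _) (hz b hb) 2)
  have hR0 : 0 ≤ R b := (norm_nonneg _).trans (hz b hb)
  have hq0 : 0 ≤ ‖z b - G‖ ^ 2 + (R b ^ 2 - ‖z b‖ ^ 2) := add_nonneg (sq_nonneg _) hR
  have hq : ‖z b - G‖ ^ 2 + (R b ^ 2 - ‖z b‖ ^ 2) ≤ τ ^ 2 * s ^ 2 := by
    have h1 := mul_le_mul_of_nonneg_right hwb hq0
    have : w₀ * (‖z b - G‖ ^ 2 + (R b ^ 2 - ‖z b‖ ^ 2)) ≤ w₀ * (τ ^ 2 * s ^ 2) := by linarith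
    exact le_of_mul_le_mul_left this hw0
  have hGs : ‖G‖ ≤ s := by
    refine le_of_abs_le (abs_le_of_sq_le_sq ?_ hs)
    have := mul_nonneg (hw b hb) hq0
    linarith
  have hdiff : ‖z b - G‖ ≤ τ * s := by
    refine le_of_abs_le (abs_le_of_sq_le_sq ?_ (by positivity))
    rw [mul_pow]; linarith
  have hτ2 : w₀ * τ ^ 2 ≤ 1 / 16 := by
    have : τ ^ 2 ≤ (1 / 4) ^ 2 := pow_le_pow_left₀ hτ0 hτ 2
    nlinarith [sq_nonneg τ]
  have hGlow : 3 / 4 * s ≤ ‖G‖ := by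
    refine le_of_abs_le (abs_le_of_sq_le_sq ?_ (norm_nonneg _))
    nlinarith [sq_nonneg s]
  have hτs : τ * s ≤ 1 / 4 * s := mul_le_mul_of_nonneg_right hτ hs
  refine ⟨hdiff, ?_, ?_⟩
  · have : ‖G‖ ≤ ‖z b‖ + ‖z b - G‖ := by
      rw [norm_sub_rev]
      simpa using norm_add_le (z b) (G - z b)
    linarith
  · have hzb : ‖z b‖ ≤ 5 / 4 * s := by
      have : ‖z b‖ ≤ ‖G‖ + ‖z b - G‖ := by simpa using norm_add_le G (z b - G)
      linarith
    refine le_of_abs_le (abs_le_of_sq_le_sq ?_ (by positivity))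
    have h1 : ‖z b‖ ^ 2 ≤ (5 / 4 * s) ^ 2 := pow_le_pow_left₀ (norm_nonneg _) hzb 2
    have h2 : τ ^ 2 * s ^ 2 ≤ (1 / 4 * s) ^ 2 := by
      rw [← mul_pow]; exact pow_le_pow_left₀ (by positivity) hτs 2
    nlinarith [sq_nonneg (‖z b - G‖)]

lemma isTame_sum_exp_mul {E β : Type*} [PseudoMetricSpace E] {I : Set E}
    {t : Finset β} {w R : β → ℝ} {F : β → E → ℂ} {ψ : β → E → ℝ} {κ κ' q s R' : ℝ}
    (hw : ∀ b ∈ t, 0 ≤ w b) (hw1 : ∑ b ∈ t, w b = 1) (hs : 0 ≤ s)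
    (hS : ∑ b ∈ t, w b * R b ^ 2 = s ^ 2)
    (hF : ∀ b ∈ t, IsTame (F b) I κ (R b))
    (hψ : ∀ b ∈ t, ∀ x ∈ I, ∀ x' ∈ I, |ψ b x - ψ b x'| ≤ q * dist x x')
    (hq0 : 0 ≤ q) (hκ0 : 0 ≤ κ)
    (hκ : q + κ ≤ κ' / 2) (hR' : s / 2 ≤ R') {I' : Set E} (hI' : I' ⊆ I)
    (hb : ∀ x ∈ I', ‖∑ b ∈ t, (w b : ℂ) * (Complex.exp (Complex.I * (ψ b x : ℂ)) * F b x)‖ ≤ R') :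
    IsTame (fun x => ∑ b ∈ t, (w b : ℂ) * (Complex.exp (Complex.I * (ψ b x : ℂ)) * F b x))
      I' κ' R' := by
  refine ⟨hb, fun x hx x' hx' => ?_⟩
  have hmean : ∑ b ∈ t, w b * R b ≤ s := by
    refine le_of_abs_le (abs_le_of_sq_le_sq ?_ hs)
    rw [← hS]
    simpa using (even_two.convexOn_pow (𝕜 := ℝ)).map_sum_le (t := t) (w := w) (p := R) hw hw1
      (fun _ _ => mem_univ _)
  rw [← Finset.sum_sub_distrib]
  have hterm : ∀ b ∈ t, ‖(w b : ℂ) * (Complex.exp (Complex.I * (ψ b x : ℂ)) * F b x) -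
      (w b : ℂ) * (Complex.exp (Complex.I * (ψ b x' : ℂ)) * F b x')‖ ≤
      w b * R b * ((q + κ) * dist x x') := by
    intro b hbt
    have e : (w b : ℂ) * (Complex.exp (Complex.I * (ψ b x : ℂ)) * F b x) -
      (w b : ℂ) * (Complex.exp (Complex.I * (ψ b x' : ℂ)) * F b x') =
      (w b : ℂ) * ((Complex.exp (Complex.I * (ψ b x : ℂ)) -
        Complex.exp (Complex.I * (ψ b x' : ℂ))) * F b x +
        Complex.exp (Complex.I * (ψ b x' : ℂ)) * (F b x - F b x')) := by ring
    rw [e, norm_mul, Complex.norm_real, Real.norm_eq_abs, abs_of_nonneg (hw b hbt), mul_assoc]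
    refine mul_le_mul_of_nonneg_left ?_ (hw b hbt)
    refine (norm_add_le _ _).trans ?_
    rw [norm_mul, norm_mul, norm_exp_I_mul_ofReal, one_mul]
    have h1 := (norm_exp_sub_exp_le (ψ b x) (ψ b x')).trans
      (hψ b hbt x (hI' hx) x' (hI' hx'))
    have h2 := mul_le_mul h1 ((hF b hbt).1 x (hI' hx)) (norm_nonneg _)
      (mul_nonneg hq0 dist_nonneg)
    have h3 := (hF b hbt).2 x (hI' hx) x' (hI' hx')
    linarith
  refine (norm_sum_le_of_le _ hterm).trans ?_
  rw [← Finset.sum_mul]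
  calc (∑ b ∈ t, w b * R b) * ((q + κ) * dist x x')
      ≤ s * (κ' / 2 * dist x x') := by
        have hd := dist_nonneg (x := x) (y := x')
        gcongr
    _ = s / 2 * κ' * dist x x' := by ring
    _ ≤ R' * κ' * dist x x' := by
        have hκ'0 : 0 ≤ κ' := by linarith
        gcongr

/-- One step of Dolgopyat's method for a single pair of cells. The amplitudes `F b` are tame on
`I` and are averaged with phases `ψ b`; at the points of two of the subsets `I' a` of `I` the mixed
difference of two phases is neither close to `0` nor larger than `1`. Then the average cannot be
aligned on both subsets, and a fraction of the mean square is lost. -/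
lemma exists_isTame_average_contraction {E α β : Type*} [PseudoMetricSpace E]
    {I : Set E} {t : Finset β} {w R : β → ℝ} {F : β → E → ℂ} {ψ : β → E → ℝ}
    {κ κ' q τ w₀ v₀ : ℝ} {u : Finset α} {v : α → ℝ} {I' : α → Set E}
    (hw : ∀ b ∈ t, 0 ≤ w b) (hw1 : ∑ b ∈ t, w b = 1)
    (hF : ∀ b ∈ t, IsTame (F b) I κ (R b))
    (hψ : ∀ b ∈ t, ∀ x ∈ I, ∀ x' ∈ I, |ψ b x - ψ b x'| ≤ q * dist x x')
    (hq0 : 0 ≤ q) (hκ0 : 0 ≤ κ) (hκ : q + κ ≤ κ' / 2) (hI' : ∀ a ∈ u, I' a ⊆ I)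
    (hτ0 : 0 ≤ τ) (hτ : τ ≤ 1 / 4) (hw0 : 0 < w₀) (hw0' : w₀ ≤ 1)
    {a₁ a₂ : α} {b₁ b₂ : β} (ha₁ : a₁ ∈ u) (ha₂ : a₂ ∈ u) (hb₁ : b₁ ∈ t) (hb₂ : b₂ ∈ t)
    (hwb₁ : w₀ ≤ w b₁) (hwb₂ : w₀ ≤ w b₂)
    (hva₁ : v₀ * ∑ a ∈ u, v a ≤ v a₁) (hva₂ : v₀ * ∑ a ∈ u, v a ≤ v a₂)
    (hphase : ∀ x₁ ∈ I' a₁, ∀ x₂ ∈ I' a₂,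
      |ψ b₁ x₁ - ψ b₂ x₁ - ψ b₁ x₂ + ψ b₂ x₂| ≤ 1 ∧
      16 * τ + 16 * κ * dist x₁ x₂ < |ψ b₁ x₁ - ψ b₂ x₁ - ψ b₁ x₂ + ψ b₂ x₂|) :
    ∃ R' : α → ℝ,
      (∀ a ∈ u, IsTame (fun x => ∑ b ∈ t, (w b : ℂ) *
        (Complex.exp (Complex.I * (ψ b x : ℂ)) * F b x)) (I' a) κ' (R' a)) ∧
      ∑ a ∈ u, v a * R' a ^ 2 ≤
        (1 - v₀ * w₀ * τ ^ 2) * ((∑ a ∈ u, v a) * ∑ b ∈ t, w b * R b ^ 2) := by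
  classical
  -- `s` is the quadratic mean of the bounds.
  obtain ⟨s, hs, hS⟩ : ∃ s : ℝ, 0 ≤ s ∧ ∑ b ∈ t, w b * R b ^ 2 = s ^ 2 :=
    ⟨√(∑ b ∈ t, w b * R b ^ 2), Real.sqrt_nonneg _, (Real.sq_sqrt
      (Finset.sum_nonneg fun b hb => mul_nonneg (hw b hb) (sq_nonneg _))).symm⟩
  set z : E → β → ℂ := fun x b => Complex.exp (Complex.I * (ψ b x : ℂ)) * F b x with hzdef
  have hz : ∀ x ∈ I, ∀ b ∈ t, ‖z x b‖ ≤ R b := by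
    intro x hx b hb
    rw [hzdef, norm_mul, norm_exp_I_mul_ofReal, one_mul]
    exact (hF b hb).1 x hx
  have hGs : ∀ x ∈ I, ‖∑ b ∈ t, (w b : ℂ) * z x b‖ ≤ s := by
    intro x hx
    refine le_of_abs_le (abs_le_of_sq_le_sq ?_ hs)
    have h1 := norm_sq_sum_add_le hw hw1 (hz x hx) hb₁
    have h2 : 0 ≤ R b₁ ^ 2 - ‖z x b₁‖ ^ 2 :=
      sub_nonneg.2 (pow_le_pow_left₀ (norm_nonneg _) (hz x hx b₁ hb₁) 2)
    have h3 := mul_nonneg (hw b₁ hb₁)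
      (add_nonneg (sq_nonneg ‖z x b₁ - ∑ b ∈ t, (w b : ℂ) * z x b‖) h2)
    linarith
  have hη : w₀ * τ ^ 2 ≤ 1 / 16 := by
    have : τ ^ 2 ≤ (1 / 4) ^ 2 := pow_le_pow_left₀ hτ0 hτ 2
    nlinarith [sq_nonneg τ]
  have hη0 : 0 ≤ w₀ * τ ^ 2 := by positivity
  -- Alignment at a point of `I' a₁` and at a point of `I' a₂` would contradict `hphase`.
  obtain ⟨a, ha, hva, hGa⟩ : ∃ a ∈ u, v₀ * ∑ a ∈ u, v a ≤ v a ∧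
      ∀ x ∈ I' a, ‖∑ b ∈ t, (w b : ℂ) * z x b‖ ^ 2 ≤ (1 - w₀ * τ ^ 2) * s ^ 2 := by
    by_contra! hcon
    obtain ⟨x₁, hx₁, hG₁⟩ := hcon a₁ ha₁ hva₁
    obtain ⟨x₂, hx₂, hG₂⟩ := hcon a₂ ha₂ hva₂
    have hx₁I := hI' a₁ ha₁ hx₁
    have hx₂I := hI' a₂ ha₂ hx₂
    have hspos : 0 < s := by
      refine lt_of_le_of_ne hs fun h0 => ?_
      have := hGs x₁ hx₁I
      rw [← h0] at this hG₁
      nlinarith [norm_nonneg (∑ b ∈ t, (w b : ℂ) * z x₁ b)]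
    obtain ⟨h11, -, hR1⟩ :=
      aligned_of_norm_sq_gt hw hw1 (hz x₁ hx₁I) hs hS hτ0 hτ hw0 hw0' hG₁ hb₁ hwb₁
    obtain ⟨h12, hlow, hR2⟩ :=
      aligned_of_norm_sq_gt hw hw1 (hz x₁ hx₁I) hs hS hτ0 hτ hw0 hw0' hG₁ hb₂ hwb₂
    obtain ⟨h21, -, -⟩ :=
      aligned_of_norm_sq_gt hw hw1 (hz x₂ hx₂I) hs hS hτ0 hτ hw0 hw0' hG₂ hb₁ hwb₁
    obtain ⟨h22, -, -⟩ :=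
      aligned_of_norm_sq_gt hw hw1 (hz x₂ hx₂I) hs hS hτ0 hτ hw0 hw0' hG₂ hb₂ hwb₂
    have hd1 : ‖z x₁ b₁ - z x₁ b₂‖ ≤ 2 * τ * s := by
      have := norm_sub_le_norm_sub_add_norm_sub (z x₁ b₁) (∑ b ∈ t, (w b : ℂ) * z x₁ b) (z x₁ b₂)
      rw [norm_sub_rev (∑ b ∈ t, (w b : ℂ) * z x₁ b)] at this
      linarith
    have hd2 : ‖z x₂ b₁ - z x₂ b₂‖ ≤ 2 * τ * s := by
      have := norm_sub_le_norm_sub_add_norm_sub (z x₂ b₁) (∑ b ∈ t, (w b : ℂ) * z x₂ b) (z x₂ b₂)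
      rw [norm_sub_rev (∑ b ∈ t, (w b : ℂ) * z x₂ b)] at this
      linarith
    have hl1 := (hF b₁ hb₁).2 x₁ hx₁I x₂ hx₂I
    have hl2 := (hF b₂ hb₂).2 x₁ hx₁I x₂ hx₂I
    have hκd : 0 ≤ κ * dist x₁ x₂ := mul_nonneg hκ0 dist_nonneg
    have hvar : ‖F b₁ x₁ - F b₁ x₂‖ + ‖F b₂ x₁ - F b₂ x₂‖ ≤ 4 * κ * dist x₁ x₂ * s := by
      have e1 := mul_le_mul_of_nonneg_right hR1 hκd
      have e2 := mul_le_mul_of_nonneg_right hR2 hκd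
      linarith
    have hlow' : s / 2 ≤ ‖F b₂ x₁‖ := by
      rwa [hzdef, norm_mul, norm_exp_I_mul_ofReal, one_mul] at hlow
    obtain ⟨hα, hα'⟩ := hphase x₁ hx₁ x₂ hx₂
    have := abs_phase_le_of_aligned hspos hlow' hd1 hd2 hvar hα
    linarith
  have hroot : √((1 - w₀ * τ ^ 2) * s ^ 2) ^ 2 = (1 - w₀ * τ ^ 2) * s ^ 2 :=
    Real.sq_sqrt (mul_nonneg (by linarith) (sq_nonneg _))
  refine ⟨fun c => if c = a then √((1 - w₀ * τ ^ 2) * s ^ 2) else s, fun c hc => ?_, ?_⟩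
  · refine isTame_sum_exp_mul hw hw1 hs hS hF hψ hq0 hκ0 hκ ?_ (hI' c hc) fun x hx => ?_
    · beta_reduce
      split_ifs
      · refine Real.le_sqrt_of_sq_le ?_
        nlinarith [sq_nonneg s]
      · linarith
    · beta_reduce
      split_ifs with h
      · subst h
        exact Real.le_sqrt_of_sq_le (hGa x hx)
      · exact hGs x (hI' c hc hx)
  · have hsum : ∑ c ∈ u, v c * (if c = a then √((1 - w₀ * τ ^ 2) * s ^ 2) else s) ^ 2 =
        (∑ c ∈ u, v c) * s ^ 2 - v a * (w₀ * τ ^ 2 * s ^ 2) := by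
      have : ∀ c ∈ u, v c * (if c = a then √((1 - w₀ * τ ^ 2) * s ^ 2) else s) ^ 2 =
          v c * s ^ 2 - (if c = a then v c * (w₀ * τ ^ 2 * s ^ 2) else 0) := by
        intro c _
        split_ifs
        · rw [hroot]; ring
        · ring
      rw [Finset.sum_congr rfl this, Finset.sum_sub_distrib, ← Finset.sum_mul,
        Finset.sum_ite_eq' u a, if_pos ha]
    rw [hsum, hS]
    have := mul_le_mul_of_nonneg_right hva (mul_nonneg hη0 (sq_nonneg s))
    linarith

/-! ### Nested partitions subordinate to nets -/

/-- A maximal `r`-separated subset of a totally bounded set, with the map to the nearest point. -/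
lemma exists_net {E : Type*} [MetricSpace E] [MeasurableSpace E] [OpensMeasurableSpace E]
    {X : Set E} (hX : TotallyBounded X) (hne : X.Nonempty) {r : ℝ} (hr : 0 < r) :
    ∃ (T : Finset E) (N : E → E), (T : Set E) ⊆ X ∧ Measurable N ∧ (∀ x, N x ∈ T) ∧
      (∀ x ∈ X, dist x (N x) ≤ r) ∧ ∀ x, ∀ t ∈ T, dist x t < r / 2 → N x = t := by
  classical
  lift r to NNReal using hr.le
  have hr' : r / 2 ≠ 0 := by
    have : (0 : NNReal) < r := by exact_mod_cast hr
    positivity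
  have hpack : Metric.packingNumber r X ≠ ⊤ := by
    have h1 := Metric.packingNumber_two_mul_le_externalCoveringNumber (r / 2) X
    rw [mul_div_cancel₀ _ two_ne_zero] at h1
    refine ne_top_of_le_ne_top ?_ h1
    obtain ⟨t, -, htfin, ht⟩ := Metric.exists_finite_isCover_of_totallyBounded hr' hX
    exact ne_top_of_le_ne_top (by simpa using htfin) ht.externalCoveringNumber_le_encard
  obtain ⟨C, hCX, hCfin, hCsep, hCcov⟩ : ∃ C ⊆ X, C.Finite ∧ Metric.IsSeparated r C ∧
      Metric.IsCover r X C := by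
    refine ⟨Metric.maximalSeparatedSet r X, Metric.maximalSeparatedSet_subset, ?_,
      Metric.isSeparated_maximalSeparatedSet, Metric.isCover_maximalSeparatedSet hpack⟩
    rw [← Set.encard_ne_top_iff, Metric.encard_maximalSeparatedSet hpack]
    exact hpack
  obtain ⟨x₀, hx₀⟩ := hne
  obtain ⟨c₀, hc₀, -⟩ := hCcov hx₀
  -- Enumerate the net by a sequence that is eventually constant.
  set l : List E := hCfin.toFinset.toList with hl
  have hmem : ∀ x, x ∈ l ↔ x ∈ C := by simp [hl]
  set e : ℕ → E := fun n => l.getD n c₀ with he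
  have heC : ∀ n, e n ∈ C := by
    intro n
    by_cases hn : n < l.length
    · rw [he]; simp only [List.getD_eq_getElem _ _ hn]
      exact (hmem _).1 (List.getElem_mem hn)
    · rw [he]; simp only [List.getD_eq_default _ _ (not_lt.1 hn)]
      exact hc₀
  have hsurj : ∀ c ∈ C, ∃ n ≤ l.length, e n = c := by
    intro c hc
    obtain ⟨n, hn, rfl⟩ := List.mem_iff_getElem.1 ((hmem c).2 hc)
    exact ⟨n, hn.le, List.getD_eq_getElem _ _ hn⟩
  have hnear : ∀ x, ∀ c ∈ C, dist (SimpleFunc.nearestPt e l.length x) x ≤ dist c x := by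
    intro x c hc
    obtain ⟨n, hn, rfl⟩ := hsurj c hc
    have := SimpleFunc.edist_nearestPt_le e x hn
    rwa [edist_dist, edist_dist, ENNReal.ofReal_le_ofReal_iff dist_nonneg] at this
  have hNC : ∀ x, SimpleFunc.nearestPt e l.length x ∈ C := fun x => heC _
  refine ⟨hCfin.toFinset, SimpleFunc.nearestPt e l.length, by simpa using hCX,
    SimpleFunc.measurable _, fun x => by simpa using hNC x, fun x hx => ?_, fun x t ht hxt => ?_⟩
  · obtain ⟨c, hc, hxc⟩ := hCcov hx
    have hxc' : dist x c ≤ r := by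
      have : edist x c ≤ r := hxc
      rw [edist_dist] at this
      exact (ENNReal.ofReal_le_coe).1 this
    rw [dist_comm]
    refine (hnear x c hc).trans ?_
    rwa [dist_comm]
  · by_contra hne
    have htC : t ∈ C := by simpa using ht
    have h1 : (r : ENNReal) < edist (SimpleFunc.nearestPt e l.length x) t := hCsep (hNC x) htC hne
    rw [edist_dist, ← ENNReal.ofReal_coe_nnreal] at h1
    replace h1 := (ENNReal.ofReal_lt_ofReal_iff_of_nonneg r.2).1 h1
    change (r : ℝ) < _ at h1
    have h2 := hnear x t htC
    have h3 := dist_triangle (SimpleFunc.nearestPt e l.length x) x t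
    rw [dist_comm t x] at h2
    linarith

/-- Nets of the set `X` at the scales `s * B ^ j`, with maps that send each point to a nearest
point of the net. -/
structure NetTower {E : Type*} [MetricSpace E] [MeasurableSpace E] (X : Set E) (s B : ℝ) where
  /-- The net at the scale `s * B ^ j`. -/
  net : ℕ → Finset E
  /-- The map to a nearest point of the net at the scale `s * B ^ j`. -/
  proj : ℕ → E → E
  net_subset : ∀ j, (net j : Set E) ⊆ X
  measurable_proj : ∀ j, Measurable (proj j)
  proj_mem : ∀ j x, proj j x ∈ net j
  dist_proj_le : ∀ j, ∀ x ∈ X, dist x (proj j x) ≤ s * B ^ j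
  proj_eq : ∀ j x, ∀ t ∈ net j, dist x t < s * B ^ j / 2 → proj j x = t

lemma nonempty_netTower {E : Type*} [MetricSpace E] [MeasurableSpace E] [OpensMeasurableSpace E]
    {X : Set E} (hX : TotallyBounded X) (hne : X.Nonempty) {s B : ℝ} (hs : 0 < s) (hB : 0 < B) :
    Nonempty (NetTower X s B) := by
  choose T N h1 h2 h3 h4 h5 using fun j : ℕ =>
    exists_net hX hne (mul_pos hs (pow_pos hB j))
  exact ⟨⟨T, N, h1, h2, h3, h4, h5⟩⟩

namespace NetTower

variable {E : Type*} [MetricSpace E] [MeasurableSpace E] {X : Set E} {s B : ℝ}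
  (T : NetTower X s B)

/-- The ancestor of a point in the net at the scale `s * B ^ j`. Ancestors are taken from one scale
to the next, so that the partitions into fibers of `T.label j` are nested. -/
def label : ℕ → E → E
  | 0 => T.proj 0
  | j + 1 => T.proj (j + 1) ∘ label j

/-- The cell of the net point `t`. The cells of a fixed scale partition the whole space. -/
def cell (j : ℕ) (t : E) : Set E := T.label j ⁻¹' {t}

/-- The net points whose cells make up the cell of `t`. -/
def children [DecidableEq E] (j : ℕ) (t : E) : Finset E :=
  (T.net j).filter fun u => T.proj (j + 1) u = t

lemma label_mem_net (j : ℕ) (x : E) : T.label j x ∈ T.net j := by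
  cases j <;> exact T.proj_mem _ _

lemma measurable_label (j : ℕ) : Measurable (T.label j) := by
  induction j with
  | zero => exact T.measurable_proj 0
  | succ j ih => exact (T.measurable_proj _).comp ih

lemma mem_cell {j : ℕ} {t x : E} : x ∈ T.cell j t ↔ T.label j x = t := Iff.rfl

lemma measurableSet_cell [MeasurableSingletonClass E] (j : ℕ) (t : E) :
    MeasurableSet (T.cell j t) :=
  T.measurable_label j (measurableSet_singleton t)

lemma mem_of_mem_net {j : ℕ} {t : E} (ht : t ∈ T.net j) : t ∈ X := T.net_subset j ht

lemma dist_label_le (hs : 0 ≤ s) (hB : 2 ≤ B) (j : ℕ) {x : E} (hx : x ∈ X) :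
    dist x (T.label j x) ≤ 2 * (s * B ^ j) := by
  induction j with
  | zero =>
    have := T.dist_proj_le 0 x hx
    have h2 : 0 ≤ s * B ^ 0 := by positivity
    change dist x (T.proj 0 x) ≤ _
    linarith
  | succ j ih =>
    have h1 := T.dist_proj_le (j + 1) _ (T.mem_of_mem_net (T.label_mem_net j x))
    have h2 := dist_triangle x (T.label j x) (T.label (j + 1) x)
    change dist _ (T.label (j + 1) x) ≤ _ at h1
    have h3 : 0 ≤ s * B ^ j := by positivity
    have h4 : s * B ^ (j + 1) = B * (s * B ^ j) := by ring
    rw [h4] at h1 ⊢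
    nlinarith

lemma dist_le_of_mem_cell (hs : 0 ≤ s) (hB : 2 ≤ B) {j : ℕ} {x t : E} (hx : x ∈ X)
    (hxt : x ∈ T.cell j t) : dist x t ≤ 2 * (s * B ^ j) := by
  rw [← T.mem_cell.1 hxt]
  exact T.dist_label_le hs hB j hx

lemma mem_cell_of_dist_lt (hs : 0 < s) (hB : 8 < B) {j : ℕ} {x t : E} (hx : x ∈ X)
    (ht : t ∈ T.net j) (hxt : dist x t < s * B ^ j / 4) : x ∈ T.cell j t := by
  cases j with
  | zero =>
    refine T.proj_eq 0 x t ht ?_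
    have : 0 < s * B ^ 0 := by positivity
    linarith
  | succ j =>
    refine T.proj_eq (j + 1) _ t ht ?_
    have h1 := T.dist_label_le hs.le (by linarith) j hx
    have h2 := dist_triangle_left (T.label j x) t x
    have h3 : 0 < s * B ^ j := by positivity
    have h4 : s * B ^ (j + 1) = B * (s * B ^ j) := by ring
    rw [h4] at hxt ⊢
    nlinarith

lemma mem_children [DecidableEq E] {j : ℕ} {t u : E} :
    u ∈ T.children j t ↔ u ∈ T.net j ∧ T.proj (j + 1) u = t := Finset.mem_filter

lemma label_mem_children [DecidableEq E] {j : ℕ} {t x : E} (hx : x ∈ T.cell (j + 1) t) :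
    T.label j x ∈ T.children j t :=
  T.mem_children.2 ⟨T.label_mem_net j x, hx⟩

lemma cell_subset_cell [DecidableEq E] {j : ℕ} {t u : E} (hu : u ∈ T.children j t) :
    T.cell j u ⊆ T.cell (j + 1) t := by
  intro x hx
  rw [mem_cell] at hx ⊢
  rw [← (T.mem_children.1 hu).2, ← hx]
  rfl

lemma dist_le_of_mem_children [DecidableEq E] {j : ℕ} {t u : E} (hu : u ∈ T.children j t) :
    dist u t ≤ s * B ^ (j + 1) := by
  obtain ⟨h1, rfl⟩ := T.mem_children.1 hu
  exact T.dist_proj_le _ _ (T.mem_of_mem_net h1)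

lemma pairwiseDisjoint_cell (j : ℕ) (S : Set E) : S.PairwiseDisjoint (T.cell j) :=
  fun _ _ _ _ h => Disjoint.preimage _ (disjoint_singleton.2 h)

lemma biUnion_cell (j : ℕ) : ⋃ t ∈ T.net j, T.cell j t = univ := by
  refine eq_univ_of_forall fun x => ?_
  simp only [mem_iUnion]
  exact ⟨T.label j x, T.label_mem_net j x, rfl⟩

lemma biUnion_children_cell [DecidableEq E] (j : ℕ) (t : E) :
    ⋃ u ∈ T.children j t, T.cell j u = T.cell (j + 1) t := by
  refine subset_antisymm (iUnion₂_subset fun u hu => T.cell_subset_cell hu) fun x hx => ?_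
  simp only [mem_iUnion]
  exact ⟨T.label j x, T.label_mem_children hx, rfl⟩

lemma sum_children [DecidableEq E] {M : Type*} [AddCommMonoid M] (j : ℕ) (f : E → M) :
    ∑ t ∈ T.net (j + 1), ∑ u ∈ T.children j t, f u = ∑ u ∈ T.net j, f u :=
  Finset.sum_fiberwise_of_maps_to (fun _ _ => T.proj_mem _ _) f

lemma sum_measureReal_children [DecidableEq E] [MeasurableSingletonClass E] (μ : Measure E)
    [IsFiniteMeasure μ] (j : ℕ) (t : E) :
    ∑ u ∈ T.children j t, μ.real (T.cell j u) = μ.real (T.cell (j + 1) t) := by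
  rw [← T.biUnion_children_cell, measureReal_biUnion_finset (T.pairwiseDisjoint_cell j _)
    fun u _ => T.measurableSet_cell j u]

lemma sum_setIntegral_children [DecidableEq E] [MeasurableSingletonClass E] {F : Type*}
    [NormedAddCommGroup F] [NormedSpace ℝ F] {μ : Measure E} {f : E → F} (hf : Integrable f μ)
    (j : ℕ) (t : E) :
    ∑ u ∈ T.children j t, ∫ x in T.cell j u, f x ∂μ = ∫ x in T.cell (j + 1) t, f x ∂μ := by
  rw [← T.biUnion_children_cell, integral_biUnion_finset _ (fun u _ => T.measurableSet_cell j u)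
    (T.pairwiseDisjoint_cell j _) fun u _ => hf.integrableOn]

lemma sum_setIntegral_net [MeasurableSingletonClass E] {F : Type*}
    [NormedAddCommGroup F] [NormedSpace ℝ F] {μ : Measure E} {f : E → F} (hf : Integrable f μ)
    (j : ℕ) : ∑ t ∈ T.net j, ∫ x in T.cell j t, f x ∂μ = ∫ x, f x ∂μ := by
  rw [← setIntegral_univ, ← T.biUnion_cell j, integral_biUnion_finset _
    (fun u _ => T.measurableSet_cell j u) (T.pairwiseDisjoint_cell j _) fun u _ => hf.integrableOn]

lemma sum_measureReal_net [MeasurableSingletonClass E] (μ : Measure E) [IsProbabilityMeasure μ]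
    (j : ℕ) : ∑ t ∈ T.net j, μ.real (T.cell j t) = 1 := by
  rw [← measureReal_biUnion_finset (T.pairwiseDisjoint_cell j _)
    fun u _ => T.measurableSet_cell j u, T.biUnion_cell]
  simp

end NetTower

/-! ### Regularity of the phase and the symbol on boxes -/

lemma convex_unitBox {d : ℕ} (a : Euc d) : Convex ℝ (unitBox a) := by
  have : unitBox a = ⋂ i, (fun x : Euc d => x i) ⁻¹' Icc (a i) (a i + 1) := by
    ext x; simp [unitBox]
  rw [this]
  refine convex_iInter fun i => ?_
  exact (convex_Icc _ _).linear_preimage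
    (EuclideanSpace.proj (𝕜 := ℝ) i : Euc d →L[ℝ] ℝ).toLinearMap

lemma isCompact_unitBox {d : ℕ} (a : Euc d) : IsCompact (unitBox a) := by
  have h : unitBox a = EuclideanSpace.equiv (Fin d) ℝ ⁻¹'
      Set.univ.pi fun i => Icc (a i) (a i + 1) := by
    ext x
    simp only [unitBox, mem_ofPred_eq, mem_preimage, Set.mem_univ_pi]
    rfl
  rw [h]
  exact (EuclideanSpace.equiv (Fin d) ℝ).toHomeomorph.isCompact_preimage.2
    (isCompact_univ_pi fun _ => isCompact_Icc)

lemma uniqueDiffOn_unitBox {d : ℕ} (a : Euc d) : UniqueDiffOn ℝ (unitBox a) := by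
  have h : unitBox a = EuclideanSpace.equiv (Fin d) ℝ ⁻¹'
      Set.univ.pi fun i => Icc (a i) (a i + 1) := by
    ext x
    simp only [unitBox, mem_ofPred_eq, mem_preimage, Set.mem_univ_pi]
    rfl
  rw [h, ContinuousLinearEquiv.uniqueDiffOn_preimage_iff]
  exact UniqueDiffOn.univ_pi fun _ => uniqueDiffOn_Icc (by linarith)

lemma norm_le_c0Norm {α F : Type*} [TopologicalSpace α] [NormedAddCommGroup F] {S : Set α}
    {g : α → F} (hS : IsCompact S) (hg : ContinuousOn g S) {z : α} (hz : z ∈ S) :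
    ‖g z‖ ≤ c0Norm S g := by
  have hbdd : BddAbove (range fun z : S => ‖g z‖) := by
    have := hS.bddAbove_image hg.norm
    rwa [image_eq_range] at this
  exact le_ciSup hbdd ⟨z, hz⟩

lemma c0Norm_nonneg {α F : Type*} [NormedAddCommGroup F] (S : Set α) (g : α → F) :
    0 ≤ c0Norm S g := Real.iSup_nonneg fun _ => norm_nonneg _

lemma c1Norm_nonneg {d : ℕ} {F : Type*} [NormedAddCommGroup F] [NormedSpace ℝ F]
    (S : Set (Euc d × Euc d)) (g : Euc d × Euc d → F) : 0 ≤ c1Norm S g :=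
  add_nonneg (c0Norm_nonneg _ _) (c0Norm_nonneg _ _)

section Box

variable {d : ℕ} {U V : Set (Euc d)}

lemma continuousOn_mixedHessian {Φ : Euc d × Euc d → ℝ} (hU : UniqueDiffOn ℝ U)
    (hV : UniqueDiffOn ℝ V) (hΦ : ContDiffOn ℝ 3 Φ (U ×ˢ V)) :
    ContinuousOn (mixedHessian (U ×ˢ V) Φ) (U ×ˢ V) := by
  have hS := hU.prod hV
  have h1 : ContDiffOn ℝ 2 (fderivWithin ℝ Φ (U ×ˢ V)) (U ×ˢ V) :=
    hΦ.fderivWithin hS (by norm_num)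
  have h2 : ContinuousOn (fderivWithin ℝ (fderivWithin ℝ Φ (U ×ˢ V)) (U ×ˢ V)) (U ×ˢ V) :=
    h1.continuousOn_fderivWithin hS (by norm_num)
  have h3 : mixedHessian (U ×ˢ V) Φ = fun z =>
      ((ContinuousLinearMap.compL ℝ (Euc d) (Euc d × Euc d) ℝ).flip
        (ContinuousLinearMap.inr ℝ (Euc d) (Euc d))).comp
      ((fderivWithin ℝ (fderivWithin ℝ Φ (U ×ˢ V)) (U ×ˢ V) z).comp
        (ContinuousLinearMap.inl ℝ (Euc d) (Euc d))) := by
    funext z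
    ext v w
    rfl
  rw [h3]
  exact continuousOn_const.clm_comp (h2.clm_comp continuousOn_const)

/-- The mixed second difference of a function is controlled by its mixed Hessian. -/
lemma abs_mixed_difference_le {Φ : Euc d × Euc d → ℝ} {A : ℝ} (hUc : Convex ℝ U)
    (hVc : Convex ℝ V) (hU : UniqueDiffOn ℝ U) (hV : UniqueDiffOn ℝ V)
    (hΦ : ContDiffOn ℝ 3 Φ (U ×ˢ V)) (hA : ∀ z ∈ U ×ˢ V, ‖mixedHessian (U ×ˢ V) Φ z‖ ≤ A)
    {x x' y y' : Euc d} (hx : x ∈ U) (hx' : x' ∈ U) (hy : y ∈ V) (hy' : y' ∈ V) :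
    |Φ (x, y) - Φ (x', y) - Φ (x, y') + Φ (x', y')| ≤ A * dist x x' * dist y y' := by
  set S := U ×ˢ V with hSdef
  have hS : UniqueDiffOn ℝ S := hU.prod hV
  have h1 : ContDiffOn ℝ 2 (fderivWithin ℝ Φ S) S := hΦ.fderivWithin hS (by norm_num)
  have hgrad : ∀ y ∈ V,
      ‖(fderivWithin ℝ Φ S (x, y)).comp (ContinuousLinearMap.inr ℝ (Euc d) (Euc d)) -
      (fderivWithin ℝ Φ S (x', y)).comp (ContinuousLinearMap.inr ℝ (Euc d) (Euc d))‖ ≤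
      A * ‖x - x'‖ := by
    intro y hy
    refine hUc.norm_image_sub_le_of_norm_hasFDerivWithin_le (𝕜 := ℝ)
      (f := fun x => (fderivWithin ℝ Φ S (x, y)).comp (ContinuousLinearMap.inr ℝ (Euc d) (Euc d)))
      (f' := fun x => mixedHessian S Φ (x, y)) (fun u hu => ?_) (fun u hu => hA _ ⟨hu, hy⟩) hx' hx
    have hd : HasFDerivWithinAt (fderivWithin ℝ Φ S)
        (fderivWithin ℝ (fderivWithin ℝ Φ S) S (u, y)) S (u, y) :=
      ((h1.differentiableOn (by norm_num)) (u, y) ⟨hu, hy⟩).hasFDerivWithinAt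
    have hmaps : MapsTo (fun v => (v, y)) U S := fun v hv => ⟨hv, hy⟩
    have hcomp := HasFDerivWithinAt.comp u hd
      (hasFDerivAt_prodMk_left (𝕜 := ℝ) u y).hasFDerivWithinAt hmaps
    have := ((ContinuousLinearMap.compL ℝ (Euc d) (Euc d × Euc d) ℝ).flip
        (ContinuousLinearMap.inr ℝ (Euc d) (Euc d))).hasFDerivAt.comp_hasFDerivWithinAt u hcomp
    exact this
  have hmain := hVc.norm_image_sub_le_of_norm_hasFDerivWithin_le (𝕜 := ℝ)
      (f := fun y => Φ (x, y) - Φ (x', y))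
      (f' := fun y => (fderivWithin ℝ Φ S (x, y)).comp (ContinuousLinearMap.inr ℝ (Euc d) (Euc d)) -
      (fderivWithin ℝ Φ S (x', y)).comp (ContinuousLinearMap.inr ℝ (Euc d) (Euc d)))
      (C := A * ‖x - x'‖) (fun v hv => ?_) hgrad hy' hy
  · rw [Real.norm_eq_abs, ← dist_eq_norm, ← dist_eq_norm] at hmain
    convert hmain using 2
    ring
  · have hd : ∀ u ∈ U, HasFDerivWithinAt (fun y => Φ (u, y))
        ((fderivWithin ℝ Φ S (u, v)).comp (ContinuousLinearMap.inr ℝ (Euc d) (Euc d))) V v := by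
      intro u hu
      have h0 : HasFDerivWithinAt Φ (fderivWithin ℝ Φ S (u, v)) S (u, v) :=
        ((hΦ.differentiableOn (by norm_num)) (u, v) ⟨hu, hv⟩).hasFDerivWithinAt
      have hmaps : MapsTo (fun w => (u, w)) V S := fun w hw => ⟨hu, hw⟩
      exact HasFDerivWithinAt.comp v h0
        (hasFDerivAt_prodMk_right (𝕜 := ℝ) u v).hasFDerivWithinAt hmaps
    exact (hd x hx).sub (hd x' hx')

lemma norm_le_c1Norm {p : Euc d × Euc d → ℂ} (hU : IsCompact U) (hV : IsCompact V)
    (hp : ContDiffOn ℝ 1 p (U ×ˢ V)) {z : Euc d × Euc d} (hz : z ∈ U ×ˢ V) :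
    ‖p z‖ ≤ c1Norm (U ×ˢ V) p :=
  (norm_le_c0Norm (hU.prod hV) hp.continuousOn hz).trans
    (le_add_of_nonneg_right (c0Norm_nonneg _ _))

lemma norm_sub_le_c1Norm {p : Euc d × Euc d → ℂ} (hUk : IsCompact U) (hVk : IsCompact V)
    (hUc : Convex ℝ U) (hU : UniqueDiffOn ℝ U) (hV : UniqueDiffOn ℝ V)
    (hp : ContDiffOn ℝ 1 p (U ×ˢ V)) {x x' y : Euc d} (hx : x ∈ U) (hx' : x' ∈ U) (hy : y ∈ V) :
    ‖p (x, y) - p (x', y)‖ ≤ c1Norm (U ×ˢ V) p * dist x x' := by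
  set S := U ×ˢ V with hSdef
  have hS : UniqueDiffOn ℝ S := hU.prod hV
  rw [dist_eq_norm]
  refine hUc.norm_image_sub_le_of_norm_hasFDerivWithin_le (𝕜 := ℝ) (f := fun x => p (x, y))
    (f' := fun u => (fderivWithin ℝ p S (u, y)).comp (ContinuousLinearMap.inl ℝ (Euc d) (Euc d)))
    (fun u hu => ?_) (fun u hu => ?_) hx' hx
  · have h0 : HasFDerivWithinAt p (fderivWithin ℝ p S (u, y)) S (u, y) :=
      ((hp.differentiableOn (by norm_num)) (u, y) ⟨hu, hy⟩).hasFDerivWithinAt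
    have hmaps : MapsTo (fun v => (v, y)) U S := fun v hv => ⟨hv, hy⟩
    exact HasFDerivWithinAt.comp u h0
      (hasFDerivAt_prodMk_left (𝕜 := ℝ) u y).hasFDerivWithinAt hmaps
  · set L := (WithLp.prodContinuousLinearEquiv 2 ℝ (Euc d) (Euc d)).toContinuousLinearMap with hL
    have hcont : ContinuousOn (fun z => (fderivWithin ℝ p S z).comp L) S :=
      (hp.continuousOn_fderivWithin hS (by norm_num)).clm_comp continuousOn_const
    have hle : ‖(fderivWithin ℝ p S (u, y)).comp L‖ ≤ c1Norm S p :=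
      (norm_le_c0Norm (hUk.prod hVk) hcont (z := (u, y)) ⟨hu, hy⟩).trans
        (le_add_of_nonneg_left (c0Norm_nonneg _ _))
    refine ContinuousLinearMap.opNorm_le_bound _ (c1Norm_nonneg _ _) fun v => ?_
    have h1 := ((fderivWithin ℝ p S (u, y)).comp L).le_of_opNorm_le hle (WithLp.toLp 2 (v, 0))
    have h2 : ‖(WithLp.toLp 2 (v, (0 : Euc d)) : WithLp 2 (Euc d × Euc d))‖ = ‖v‖ := by
      rw [WithLp.prod_norm_eq_of_L2]; simp
    rw [h2] at h1
    exact h1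

end Box

/-! ### Doubling measures charge the cells of a tower -/

lemma mem_cube_of_dist_le {d : ℕ} {x y : Euc d} {r : ℝ} (h : dist y x ≤ r / 2) :
    y ∈ cube x r := by
  intro i
  refine le_trans ?_ h
  rw [dist_eq_norm]
  simpa using PiLp.norm_apply_le (y - x) i

lemma dist_le_of_mem_cube {d : ℕ} {x y : Euc d} {r : ℝ} (hr : 0 ≤ r) (h : y ∈ cube x r) :
    dist y x ≤ d * (r / 2) := by
  rw [EuclideanSpace.dist_eq]
  refine Real.sqrt_le_iff.2 ⟨by positivity, ?_⟩
  have h1 : ∑ i, dist (y i) (x i) ^ 2 ≤ ∑ _i : Fin d, (r / 2) ^ 2 :=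
    Finset.sum_le_sum fun i _ => pow_le_pow_left₀ dist_nonneg (h i) 2
  refine h1.trans ?_
  rw [Finset.sum_const, Finset.card_univ, Fintype.card_fin, nsmul_eq_mul, mul_pow]
  refine mul_le_mul_of_nonneg_right ?_ (by positivity)
  rcases Nat.eq_zero_or_pos d with rfl | hd
  · simp
  · have : (1 : ℝ) ≤ d := by exact_mod_cast hd
    nlinarith

lemma IsDoubling.measureReal_cube_le {d : ℕ} {μ : Measure (Euc d)} [IsFiniteMeasure μ]
    {h C : ℝ} (hμ : IsDoubling μ h C) {x : Euc d} (hx : x ∈ μ.support) {s : ℝ} (hs0 : 0 ≤ s)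
    (hs : h ≤ s) : ∀ n : ℕ, 2 ^ n * s ≤ 1 →
      μ.real (cube x (2 ^ n * s)) ≤ C ^ n * μ.real (cube x s) := by
  intro n
  induction n with
  | zero => intro _; simp
  | succ n ih =>
    intro hn
    rw [pow_succ] at hn
    have h1 : (1 : ℝ) ≤ 2 ^ n := one_le_pow₀ one_le_two
    have h2 := hμ.2 (2 ^ n * s) ⟨by nlinarith, by linarith⟩ x hx
    have h3 := ENNReal.toReal_mono
      (ENNReal.mul_ne_top ENNReal.ofReal_ne_top (measure_ne_top μ _)) h2
    rw [ENNReal.toReal_mul, ENNReal.toReal_ofReal hμ.1.le] at h3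
    have h4 := mul_le_mul_of_nonneg_left (ih (by nlinarith)) hμ.1.le
    have e : (2 : ℝ) ^ (n + 1) * s = 2 * (2 ^ n * s) := by ring
    rw [e]
    calc μ.real (cube x (2 * (2 ^ n * s))) ≤ C * μ.real (cube x (2 ^ n * s)) := h3
      _ ≤ C * (C ^ n * μ.real (cube x s)) := h4
      _ = C ^ (n + 1) * μ.real (cube x s) := by ring

lemma measureReal_le_of_inter_support_subset {E : Type*} [TopologicalSpace E] [MeasurableSpace E]
    [HereditarilyLindelofSpace E] {μ : Measure E} [IsFiniteMeasure μ] {s t : Set E}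
    (h : s ∩ μ.support ⊆ t) : μ.real s ≤ μ.real t := by
  refine ENNReal.toReal_mono (measure_ne_top μ t) (measure_mono_ae ?_)
  filter_upwards [Measure.support_mem_ae (μ := μ)] with x hx hxs
  exact h ⟨hxs, hx⟩

/-- A doubling measure charges each cell by a fixed fraction of the mass of the next larger cell:
`N` doublings of a cube inside the small cell cover the large one. -/
lemma IsDoubling.measureReal_cell_le {d : ℕ} (hd : 1 ≤ d) {μ : Measure (Euc d)} [IsFiniteMeasure μ]
    {h C s B : ℝ} (hμ : IsDoubling μ h C) (T : NetTower μ.support s B) (hs : 0 < s) (hB : 8 < B)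
    {j N : ℕ} (hsmall : h ≤ s * B ^ j / (4 * d)) (hN : 24 * d * B ≤ 2 ^ N)
    (hlarge : 2 ^ N * (s * B ^ j) ≤ 4 * d) {t u : Euc d} (hu : u ∈ T.children j t) :
    μ.real (T.cell (j + 1) t) ≤ C ^ N * μ.real (T.cell j u) := by
  have hd' : (1 : ℝ) ≤ d := by exact_mod_cast hd
  have hd0 : (0 : ℝ) < d := by linarith
  have hunet := (T.mem_children.1 hu).1
  have husupp := T.mem_of_mem_net hunet
  have hr : 0 < s * B ^ j := mul_pos hs (pow_pos (by linarith) _)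
  set r := s * B ^ j / (4 * d) with hrdef
  have hr0 : 0 < r := by positivity
  have hrd : s * B ^ j = 4 * d * r := by rw [hrdef]; field_simp
  have h1 : μ.real (T.cell (j + 1) t) ≤ μ.real (cube u (2 ^ N * r)) := by
    refine measureReal_le_of_inter_support_subset fun x hx => mem_cube_of_dist_le ?_
    have e1 := T.dist_le_of_mem_cell hs.le (by linarith) hx.2 hx.1
    have e2 := T.dist_le_of_mem_children hu
    have e3 := dist_triangle_right x u t
    have e4 : s * B ^ (j + 1) = 4 * d * B * r := by rw [pow_succ, ← mul_assoc, hrd]; ring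
    have e5 := mul_le_mul_of_nonneg_right hN hr0.le
    rw [e4] at e1 e2
    linarith
  have h2 : μ.real (cube u r) ≤ μ.real (T.cell j u) := by
    refine measureReal_le_of_inter_support_subset fun x hx => ?_
    refine T.mem_cell_of_dist_lt hs hB hx.2 hunet ?_
    have := dist_le_of_mem_cube hr0.le hx.1
    rw [hrd]
    nlinarith
  refine h1.trans ((hμ.measureReal_cube_le husupp hr0.le hsmall N ?_).trans ?_)
  · rw [hrdef, ← mul_div_assoc, div_le_one (by positivity)]
    exact hlarge
  · exact mul_le_mul_of_nonneg_left h2 (pow_nonneg hμ.1.le _)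

/-! ### The energy of the cell averages loses a fraction at each scale -/

/-- The integrand `exp (i Φ(x, z) / h) p(x, z) f(z)` of the oscillatory integral operator. -/
def oscIntegrand {d : ℕ} (Φ : Euc d × Euc d → ℝ) (p : Euc d × Euc d → ℂ) (h : ℝ)
    (f : Euc d → ℂ) (x z : Euc d) : ℂ :=
  Complex.exp (Complex.I * ((Φ (x, z) / h : ℝ) : ℂ)) * p (x, z) * f z

/-- The average over the set `J` of the oscillatory integrand, with the phase normalized to vanish
at the base point `y`. This removes the fast oscillation in `x` that all of `J` has in common. -/
def cellAverage {d : ℕ} (Φ : Euc d × Euc d → ℝ) (p : Euc d × Euc d → ℂ) (h : ℝ)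
    (μ : Measure (Euc d)) (f : Euc d → ℂ) (J : Set (Euc d)) (y x : Euc d) : ℂ :=
  (μ.real J : ℂ)⁻¹ * (Complex.exp (Complex.I * ((-(Φ (x, y) / h) : ℝ) : ℂ)) *
    ∫ z in J, oscIntegrand Φ p h f x z ∂μ)

lemma measureReal_cell_pos {d : ℕ} {μ : Measure (Euc d)} [IsFiniteMeasure μ] {s B : ℝ}
    (T : NetTower μ.support s B) (hs : 0 < s) (hB : 8 < B) {j : ℕ} {t : Euc d}
    (ht : t ∈ T.net j) : 0 < μ.real (T.cell j t) := by
  have hr : 0 < s * B ^ j / 4 := div_pos (mul_pos hs (pow_pos (by linarith) _)) (by norm_num)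
  have h1 : 0 < μ (Metric.ball t (s * B ^ j / 4)) :=
    (Measure.mem_support_iff_forall _).1 (T.mem_of_mem_net ht) _ (Metric.ball_mem_nhds t hr)
  have h2 : 0 < μ.real (Metric.ball t (s * B ^ j / 4)) :=
    ENNReal.toReal_pos h1.ne' (measure_ne_top _ _)
  refine h2.trans_le (measureReal_le_of_inter_support_subset fun x hx => ?_)
  exact T.mem_cell_of_dist_lt hs hB hx.2 ht hx.1

/-- Constants for one step of Dolgopyat's method. At scales `ρ` in `x` and `B * σ` in `y` with
`ρ * σ = h`, nonorthogonality is used with the radii `ξ * ρ` and `Z * σ`. The phase difference it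
produces is of size `c * ξ * Z`; `phase_gt` says that it beats both the error of moving points
inside the cells of the next scale and the variation of the amplitudes, `phase_le` that it does not
wrap around the circle. -/
structure StepConstants (A c B ξ Z τ : ℝ) : Prop where
  one_le_A : 1 ≤ A
  lt_B : 8 < B
  pos_ξ : 0 < ξ
  ξ_le : ξ ≤ 1 / 4
  one_lt_ξ_mul : 1 < ξ * B ^ 2
  one_le_Z : 1 ≤ Z
  Z_le : 8 * Z ≤ B
  nonneg_τ : 0 ≤ τ
  τ_le : τ ≤ 1 / 4
  phase_le : A * (2 * ξ + 8 / B) * (2 * Z + 4) ≤ 1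
  phase_gt : 16 * τ + 64 * A * (2 * ξ + 8 / B) <
    c * ξ * Z - 16 * A * Z / B - 8 * A * ξ - 32 * A / B

/-- Nonorthogonality inside a pair of cells: two pairs of subcells whose mixed phase difference is
bounded away from `0`, uniformly over points of the `x`-subcells. -/
lemma exists_separated_phases {d : ℕ} {X Y : Set (Euc d)} {Φ : Euc d × Euc d → ℝ}
    {A c h B ξ Z τ sX sY : ℝ} (K : StepConstants A c B ξ Z τ)
    (hΦ : ∀ x ∈ X, ∀ x' ∈ X, ∀ y ∈ Y, ∀ y' ∈ Y,
      |Φ (x, y) - Φ (x', y) - Φ (x, y') + Φ (x', y')| ≤ A * dist x x' * dist y y')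
    (hN : IsNonorthogonal Φ X Y c h h 1 1)
    (hsX : 0 < sX) (hsY : 0 < sY) (TX : NetTower X sX B) (TY : NetTower Y sY B) {i j : ℕ}
    (hh : sX * B ^ (i + 1) * (sY * B ^ j) = h)
    (hX1 : sX * B ^ (i + 1) * B ≤ 1) (hY1 : sY * B ^ (j + 1) * B ≤ 1)
    {t y : Euc d} (ht : t ∈ TX.net (i + 1)) (hy : y ∈ TY.net (j + 1)) :
    ∃ a₁ ∈ TX.children i t, ∃ a₂ ∈ TX.children i t,
    ∃ b₁ ∈ TY.children j y, ∃ b₂ ∈ TY.children j y,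
    ∀ x₁ ∈ TX.cell i a₁ ∩ X, ∀ x₂ ∈ TX.cell i a₂ ∩ X,
      |Φ (x₁, b₁) - Φ (x₂, b₁) - Φ (x₁, b₂) + Φ (x₂, b₂)| ≤ h ∧
      (16 * τ + 16 * (4 * A / (sX * B ^ (i + 1))) * dist x₁ x₂) * h <
        |Φ (x₁, b₁) - Φ (x₂, b₁) - Φ (x₁, b₂) + Φ (x₂, b₂)| := by
  have hA := K.one_le_A
  have hB := K.lt_B
  have hξ := K.pos_ξ
  have hZ := K.one_le_Z
  have hB0 : 0 < B := by linarith
  set ρ := sX * B ^ (i + 1) with hρdef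
  set σ := sY * B ^ j with hσdef
  have hρ : 0 < ρ := mul_pos hsX (pow_pos hB0 _)
  have hσ : 0 < σ := mul_pos hsY (pow_pos hB0 _)
  have hσB : sY * B ^ (j + 1) = σ * B := by rw [hσdef]; ring
  have hρB : sX * B ^ i = ρ / B := by rw [hρdef, pow_succ]; field_simp
  rw [hσB] at hY1
  have hh0 : 0 < h := hh ▸ mul_pos hρ hσ
  have hσξ : σ < ξ := by
    have := K.one_lt_ξ_mul
    nlinarith [pow_pos hB0 2]
  have hρ1 : ρ < 1 := by nlinarith
  have hrX : ξ * ρ ∈ Ioo h 1 := by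
    refine ⟨?_, ?_⟩
    · rw [← hh, mul_comm]; exact mul_lt_mul_of_pos_right hσξ hρ
    · nlinarith [K.ξ_le]
  have hrY : Z * σ ∈ Ioo h 1 := by
    refine ⟨?_, ?_⟩
    · rw [← hh]; exact mul_lt_mul_of_pos_right (by linarith) hσ
    · have := mul_le_mul_of_nonneg_right K.Z_le hσ.le
      nlinarith
  obtain ⟨-, -, hN⟩ := hN
  obtain ⟨x₁, hx₁, x₂, hx₂, y₁, hy₁, y₂, hy₂, hM⟩ :=
    hN t (TX.mem_of_mem_net ht) y (TY.mem_of_mem_net hy) _ hrX _ hrY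
  have hcellX : ∀ x ∈ X ∩ Metric.ball t (ξ * ρ), x ∈ TX.cell (i + 1) t := by
    intro x hx
    refine TX.mem_cell_of_dist_lt hsX hB hx.1 ht ?_
    have h1 := Metric.mem_ball.1 hx.2
    have := K.ξ_le
    rw [← hρdef]
    nlinarith
  have hcellY : ∀ z ∈ Y ∩ Metric.ball y (Z * σ), z ∈ TY.cell (j + 1) y := by
    intro z hz
    refine TY.mem_cell_of_dist_lt hsY hB hz.1 hy ?_
    have h1 := Metric.mem_ball.1 hz.2
    have := K.Z_le
    rw [hσB]
    nlinarith
  refine ⟨_, TX.label_mem_children (hcellX x₁ hx₁), _, TX.label_mem_children (hcellX x₂ hx₂),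
    _, TY.label_mem_children (hcellY y₁ hy₁), _, TY.label_mem_children (hcellY y₂ hy₂),
    fun x₁' hx₁' x₂' hx₂' => ?_⟩
  have hmove : ∀ x ∈ X, ∀ x' ∈ TX.cell i (TX.label i x) ∩ X, dist x x' ≤ 4 * (ρ / B) := by
    intro x hx x' hx'
    have e1 := TX.dist_label_le hsX.le (by linarith) i hx
    have e2 := TX.dist_le_of_mem_cell hsX.le (by linarith) hx'.2 hx'.1
    have e3 := dist_triangle_right x x' (TX.label i x)
    rw [hρB] at e1 e2
    linarith
  have d1 := hmove x₁ hx₁.1 x₁' hx₁'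
  have d2 := hmove x₂ hx₂.1 x₂' hx₂'
  have db1 : dist y₁ (TY.label j y₁) ≤ 2 * σ := TY.dist_label_le hsY.le (by linarith) j hy₁.1
  have db2 : dist y₂ (TY.label j y₂) ≤ 2 * σ := TY.dist_label_le hsY.le (by linarith) j hy₂.1
  have hb1 := TY.mem_of_mem_net (TY.label_mem_net j y₁)
  have hb2 := TY.mem_of_mem_net (TY.label_mem_net j y₂)
  set b₁ := TY.label j y₁
  set b₂ := TY.label j y₂
  have dx : dist x₁ x₂ ≤ 2 * (ξ * ρ) := by
    have := dist_triangle_right x₁ x₂ t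
    linarith [Metric.mem_ball.1 hx₁.2, Metric.mem_ball.1 hx₂.2]
  have dy : dist y₁ y₂ ≤ 2 * (Z * σ) := by
    have := dist_triangle_right y₁ y₂ y
    linarith [Metric.mem_ball.1 hy₁.2, Metric.mem_ball.1 hy₂.2]
  have dx' : dist x₁' x₂' ≤ (2 * ξ + 8 / B) * ρ := by
    have e1 := dist_triangle4 x₁' x₁ x₂ x₂'
    rw [dist_comm x₁' x₁] at e1
    have : (2 * ξ + 8 / B) * ρ = 2 * (ξ * ρ) + 8 * (ρ / B) := by ring
    rw [this]
    linarith
  have dy' : dist b₁ b₂ ≤ (2 * Z + 4) * σ := by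
    have e1 := dist_triangle4 b₁ y₁ y₂ b₂
    rw [dist_comm b₁ y₁] at e1
    linarith
  have bound : ∀ {u v w r : ℝ}, 0 ≤ u → 0 ≤ v → u ≤ w → v ≤ r → A * u * v ≤ A * w * r :=
    fun hu hv huw hvr =>
      mul_le_mul (mul_le_mul_of_nonneg_left huw (by linarith)) hvr hv
        (mul_nonneg (by linarith) (hu.trans huw))
  have m1 := (hΦ x₁ hx₁.1 x₁' hx₁'.2 y₁ hy₁.1 y₂ hy₂.1).trans
    (bound dist_nonneg dist_nonneg d1 dy)
  have m2 := (hΦ x₂ hx₂.1 x₂' hx₂'.2 y₁ hy₁.1 y₂ hy₂.1).trans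
    (bound dist_nonneg dist_nonneg d2 dy)
  have m3 := (hΦ x₁' hx₁'.2 x₂' hx₂'.2 y₁ hy₁.1 b₁ hb1).trans
    (bound dist_nonneg dist_nonneg dx' db1)
  have m4 := (hΦ x₁' hx₁'.2 x₂' hx₂'.2 y₂ hy₂.1 b₂ hb2).trans
    (bound dist_nonneg dist_nonneg dx' db2)
  have m5 := (hΦ x₁' hx₁'.2 x₂' hx₂'.2 b₁ hb1 b₂ hb2).trans
    (bound dist_nonneg dist_nonneg dx' dy')
  refine ⟨m5.trans ?_, ?_⟩
  · have := mul_le_mul_of_nonneg_right K.phase_le hh0.le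
    rw [← hh] at this ⊢
    linarith
  · have htotal : c * (ξ * ρ) * (Z * σ) - 2 * (A * (4 * (ρ / B)) * (2 * (Z * σ))) -
        2 * (A * ((2 * ξ + 8 / B) * ρ) * (2 * σ)) ≤
        |Φ (x₁', b₁) - Φ (x₂', b₁) - Φ (x₁', b₂) + Φ (x₂', b₂)| := by
      have e1 := abs_le.1 m1
      have e2 := abs_le.1 m2
      have e3 := abs_le.1 m3
      have e4 := abs_le.1 m4
      rcases le_abs.1 hM with hM | hM
      · refine le_trans ?_ (le_abs_self _)
        linarith
      · refine le_trans ?_ (neg_le_abs _)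
        linarith
    refine lt_of_lt_of_le ?_ htotal
    have hκ : (16 * τ + 16 * (4 * A / ρ) * dist x₁' x₂') * h ≤
        (16 * τ + 64 * A * (2 * ξ + 8 / B)) * h := by
      refine mul_le_mul_of_nonneg_right ?_ hh0.le
      have e1 : 16 * (4 * A / ρ) * dist x₁' x₂' = 64 * A * (dist x₁' x₂' / ρ) := by ring
      have e2 : dist x₁' x₂' / ρ ≤ 2 * ξ + 8 / B := (div_le_iff₀ hρ).2 dx'
      rw [e1]
      have : 64 * A * (dist x₁' x₂' / ρ) ≤ 64 * A * (2 * ξ + 8 / B) := by gcongr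
      linarith
    refine hκ.trans_lt ((mul_lt_mul_of_pos_right K.phase_gt hh0).trans_le (le_of_eq ?_))
    rw [← hh]
    ring

/-- The amplitudes at scale `i` in `x` and scale `j` in `y` are tame on the cells, and the total
quadratic mean of the bounds is at most `M`. -/
def HasEnergyBound {d : ℕ} {sX sY B : ℝ} (μX μY : Measure (Euc d))
    (TX : NetTower μX.support sX B) (TY : NetTower μY.support sY B)
    (G : ℕ → Euc d → Euc d → ℂ) (A : ℝ) (i j : ℕ) (M : ℝ) : Prop :=
  ∃ R : Euc d → Euc d → ℝ,
    (∀ t ∈ TX.net i, ∀ y ∈ TY.net j,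
      IsTame (G j y) (TX.cell i t ∩ μX.support) (4 * A / (sX * B ^ i)) (R t y)) ∧
    ∑ t ∈ TX.net i, ∑ y ∈ TY.net j,
      μX.real (TX.cell i t) * (μY.real (TY.cell j y) * R t y ^ 2) ≤ M

/-- The average over a cell is the weighted mean of the averages over its subcells, modulated by the
phase differences of the base points. -/
lemma cellAverage_succ {d : ℕ} {μ : Measure (Euc d)} [IsFiniteMeasure μ] {s B : ℝ}
    (T : NetTower μ.support s B) {Φ : Euc d × Euc d → ℝ} {p : Euc d × Euc d → ℂ} {h : ℝ}
    {f : Euc d → ℂ} {x : Euc d} (hint : Integrable (oscIntegrand Φ p h f x) μ)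
    (j : ℕ) (y : Euc d) :
    cellAverage Φ p h μ f (T.cell (j + 1) y) y x =
      ∑ b ∈ T.children j y, ((μ.real (T.cell j b) / μ.real (T.cell (j + 1) y) : ℝ) : ℂ) *
        (Complex.exp (Complex.I * (((Φ (x, b) - Φ (x, y)) / h : ℝ) : ℂ)) *
          cellAverage Φ p h μ f (T.cell j b) b x) := by
  rw [cellAverage, ← T.sum_setIntegral_children hint, Finset.mul_sum, Finset.mul_sum]
  refine Finset.sum_congr rfl fun b _ => ?_
  have hexp : Complex.exp (Complex.I * (((Φ (x, b) - Φ (x, y)) / h : ℝ) : ℂ)) *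
      Complex.exp (Complex.I * ((-(Φ (x, b) / h) : ℝ) : ℂ)) =
      Complex.exp (Complex.I * ((-(Φ (x, y) / h) : ℝ) : ℂ)) := by
    rw [← Complex.exp_add, ← mul_add, ← Complex.ofReal_add]
    congr 3
    ring
  by_cases h0 : μ.real (T.cell j b) = 0
  · have : ∫ z in T.cell j b, oscIntegrand Φ p h f x z ∂μ = 0 := by
      rw [Measure.restrict_eq_zero.2 ((measureReal_eq_zero_iff).1 h0), integral_zero_measure]
    rw [this, h0]
    simp
  · have h0' : (μ.real (T.cell j b) : ℂ) ≠ 0 := by exact_mod_cast h0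
    rw [cellAverage, ← hexp]
    push_cast
    field_simp

/-- The energy decrement: passing to the next smaller scale in `x` and the next larger
scale in `y` loses a fixed fraction of the energy. -/
lemma HasEnergyBound.step {d : ℕ} (hd : 1 ≤ d) {μX μY : Measure (Euc d)} [IsProbabilityMeasure μX]
    [IsProbabilityMeasure μY] {Φ : Euc d × Euc d → ℝ} {p : Euc d × Euc d → ℂ} {f : Euc d → ℂ}
    {A c h B ξ Z τ sX sY CX CY M : ℝ} {N : ℕ} (K : StepConstants A c B ξ Z τ)
    (hΦ : ∀ x ∈ μX.support, ∀ x' ∈ μX.support, ∀ y ∈ μY.support, ∀ y' ∈ μY.support,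
      |Φ (x, y) - Φ (x', y) - Φ (x, y') + Φ (x', y')| ≤ A * dist x x' * dist y y')
    (hN : IsNonorthogonal Φ μX.support μY.support c h h 1 1)
    (hDX : IsDoubling μX h CX) (hDY : IsDoubling μY h CY) (hCY : 1 ≤ CY)
    (hint : ∀ x ∈ μX.support, Integrable (oscIntegrand Φ p h f x) μY)
    (hsX : 0 < sX) (hsY : 0 < sY)
    (TX : NetTower μX.support sX B) (TY : NetTower μY.support sY B) {i j : ℕ}
    (hh : sX * B ^ (i + 1) * (sY * B ^ j) = h)
    (hX1 : sX * B ^ (i + 1) * B ≤ 1) (hY1 : sY * B ^ (j + 1) * B ≤ 1)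
    (hN1 : 24 * d * B ≤ 2 ^ N) (hN2 : 2 ^ N ≤ 4 * d * B ^ 2) (hdB : 4 * d ≤ B)
    (hE : HasEnergyBound μX μY TX TY
      (fun j y => cellAverage Φ p h μY f (TY.cell j y) y) A (i + 1) j M) :
    HasEnergyBound μX μY TX TY (fun j y => cellAverage Φ p h μY f (TY.cell j y) y) A i (j + 1)
      ((1 - (CX ^ N)⁻¹ * (CY ^ N)⁻¹ * τ ^ 2) * M) := by
  have hd1 : (1 : ℝ) ≤ d := by exact_mod_cast hd
  have hd0 : (0 : ℝ) < d := by linarith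
  have hA := K.one_le_A
  have hB := K.lt_B
  have hB0 : 0 < B := by linarith
  obtain ⟨R, hR, hM⟩ := hE
  have hρ : 0 < sX * B ^ (i + 1) := mul_pos hsX (pow_pos hB0 _)
  have hρ' : 0 < sX * B ^ i := mul_pos hsX (pow_pos hB0 _)
  have hσ : 0 < sY * B ^ j := mul_pos hsY (pow_pos hB0 _)
  have eρ : sX * B ^ (i + 1) = sX * B ^ i * B := by ring
  have eσ : sY * B ^ (j + 1) = sY * B ^ j * B := by ring
  have hh0 : 0 < h := hh ▸ mul_pos hρ hσ
  -- `N` doublings stay below the unit scale, and all scales involved are above `h`.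
  have hdX : ∀ t, ∀ u ∈ TX.children i t,
      μX.real (TX.cell (i + 1) t) ≤ CX ^ N * μX.real (TX.cell i u) := by
    intro t u hu
    refine hDX.measureReal_cell_le hd TX hsX hB ?_ hN1 ?_ hu
    · rw [le_div_iff₀ (by positivity), ← hh, eρ]
      rw [eσ] at hY1
      have : B * (sY * B ^ j) * (4 * d) ≤ 1 := by nlinarith
      calc sX * B ^ i * B * (sY * B ^ j) * (4 * d)
          = sX * B ^ i * (B * (sY * B ^ j) * (4 * d)) := by ring
        _ ≤ sX * B ^ i * 1 := mul_le_mul_of_nonneg_left this hρ'.le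
        _ = sX * B ^ i := mul_one _
    · rw [eρ] at hX1
      calc 2 ^ N * (sX * B ^ i) ≤ 4 * d * B ^ 2 * (sX * B ^ i) :=
            mul_le_mul_of_nonneg_right hN2 hρ'.le
        _ = 4 * d * (sX * B ^ i * B * B) := by ring
        _ ≤ 4 * d * 1 := mul_le_mul_of_nonneg_left hX1 (by positivity)
        _ = 4 * d := mul_one _
  have hdY : ∀ y, ∀ b ∈ TY.children j y,
      μY.real (TY.cell (j + 1) y) ≤ CY ^ N * μY.real (TY.cell j b) := by
    intro y b hb
    refine hDY.measureReal_cell_le hd TY hsY hB ?_ hN1 ?_ hb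
    · rw [le_div_iff₀ (by positivity), ← hh]
      have : sX * B ^ (i + 1) * (4 * d) ≤ 1 := by nlinarith
      nlinarith
    · rw [eσ] at hY1
      calc 2 ^ N * (sY * B ^ j) ≤ 4 * d * B ^ 2 * (sY * B ^ j) :=
            mul_le_mul_of_nonneg_right hN2 hσ.le
        _ = 4 * d * (sY * B ^ j * B * B) := by ring
        _ ≤ 4 * d * 1 := mul_le_mul_of_nonneg_left hY1 (by positivity)
        _ = 4 * d := mul_one _
  have hCXN : 0 < CX ^ N := pow_pos hDX.1 N
  have hCYN : 0 < CY ^ N := pow_pos hDY.1 N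
  have hlocal : ∀ t y, ∃ R' : Euc d → ℝ, t ∈ TX.net (i + 1) → y ∈ TY.net (j + 1) →
      (∀ a ∈ TX.children i t, IsTame (cellAverage Φ p h μY f (TY.cell (j + 1) y) y)
        (TX.cell i a ∩ μX.support) (4 * A / (sX * B ^ i)) (R' a)) ∧
      ∑ a ∈ TX.children i t, μX.real (TX.cell i a) * R' a ^ 2 ≤
        (1 - (CX ^ N)⁻¹ * (CY ^ N)⁻¹ * τ ^ 2) * (μX.real (TX.cell (i + 1) t) *
          ∑ b ∈ TY.children j y,
            μY.real (TY.cell j b) / μY.real (TY.cell (j + 1) y) * R t b ^ 2) := by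
    intro t y
    by_cases hty : t ∈ TX.net (i + 1) ∧ y ∈ TY.net (j + 1)
    swap
    · exact ⟨fun _ => 0, fun h1 h2 => absurd ⟨h1, h2⟩ hty⟩
    obtain ⟨ht, hy⟩ := hty
    have hW := measureReal_cell_pos TY hsY hB hy
    obtain ⟨a₁, ha₁, a₂, ha₂, b₁, hb₁, b₂, hb₂, hsep⟩ :=
      exists_separated_phases K hΦ hN hsX hsY TX TY hh hX1 hY1 ht hy
    have hwb : ∀ b ∈ TY.children j y,
        (CY ^ N)⁻¹ ≤ μY.real (TY.cell j b) / μY.real (TY.cell (j + 1) y) := by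
      intro b hb
      rw [le_div_iff₀ hW, inv_mul_le_iff₀ hCYN]
      exact hdY y b hb
    have hva : ∀ a ∈ TX.children i t, (CX ^ N)⁻¹ *
        ∑ a ∈ TX.children i t, μX.real (TX.cell i a) ≤ μX.real (TX.cell i a) := by
      intro a ha
      rw [TX.sum_measureReal_children, inv_mul_le_iff₀ hCXN]
      exact hdX t a ha
    obtain ⟨R', h1, h2⟩ := exists_isTame_average_contraction
      (I := TX.cell (i + 1) t ∩ μX.support) (t := TY.children j y)
      (w := fun b => μY.real (TY.cell j b) / μY.real (TY.cell (j + 1) y)) (R := R t)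
      (F := fun b => cellAverage Φ p h μY f (TY.cell j b) b)
      (ψ := fun b x => (Φ (x, b) - Φ (x, y)) / h) (κ := 4 * A / (sX * B ^ (i + 1)))
      (κ' := 4 * A / (sX * B ^ i)) (q := A * B / (sX * B ^ (i + 1))) (τ := τ)
      (w₀ := (CY ^ N)⁻¹) (v₀ := (CX ^ N)⁻¹) (u := TX.children i t)
      (v := fun a => μX.real (TX.cell i a)) (I' := fun a => TX.cell i a ∩ μX.support)
      (fun b _ => by positivity)
      (by rw [← Finset.sum_div, TY.sum_measureReal_children, div_self hW.ne'])
      (fun b hb => hR t ht b (TY.mem_children.1 hb).1)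
      (fun b hb x hx x' hx' => by
        rw [← sub_div, abs_div, abs_of_pos hh0, div_le_iff₀ hh0]
        have e1 := hΦ x hx.2 x' hx'.2 b (TY.mem_of_mem_net (TY.mem_children.1 hb).1) y
          (TY.mem_of_mem_net hy)
        have e2 := TY.dist_le_of_mem_children hb
        have e3 : Φ (x, b) - Φ (x, y) - (Φ (x', b) - Φ (x', y)) =
          Φ (x, b) - Φ (x', b) - Φ (x, y) + Φ (x', y) := by ring
        rw [e3]
        refine e1.trans ?_
        have e4 : A * B / (sX * B ^ (i + 1)) * dist x x' * h =
            A * dist x x' * (sY * B ^ (j + 1)) := by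
          rw [← hh]
          field_simp
          ring
        rw [e4]
        exact mul_le_mul_of_nonneg_left e2 (mul_nonneg (by linarith) dist_nonneg))
      (by positivity) (by positivity)
      (by
        have e1 : A * B / (sX * B ^ (i + 1)) + 4 * A / (sX * B ^ (i + 1)) =
            A * (B + 4) / (sX * B ^ (i + 1)) := by ring
        have e2 : 4 * A / (sX * B ^ i) / 2 = A * (2 * B) / (sX * B ^ (i + 1)) := by
          rw [eρ]; field_simp; ring
        rw [e1, e2]
        gcongr
        linarith)
      (fun a ha => inter_subset_inter_left _ (TX.cell_subset_cell ha))
      K.nonneg_τ K.τ_le (inv_pos.2 hCYN) (inv_le_one_of_one_le₀ (one_le_pow₀ hCY))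
      ha₁ ha₂ hb₁ hb₂ (hwb _ hb₁) (hwb _ hb₂) (hva _ ha₁) (hva _ ha₂)
      (fun x₁ hx₁ x₂ hx₂ => by
        obtain ⟨e1, e2⟩ := hsep x₁ hx₁ x₂ hx₂
        have e3 : (Φ (x₁, b₁) - Φ (x₁, y)) / h - (Φ (x₁, b₂) - Φ (x₁, y)) / h -
            (Φ (x₂, b₁) - Φ (x₂, y)) / h + (Φ (x₂, b₂) - Φ (x₂, y)) / h =
            (Φ (x₁, b₁) - Φ (x₂, b₁) - Φ (x₁, b₂) + Φ (x₂, b₂)) / h := by ring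
        rw [e3, abs_div, abs_of_pos hh0]
        exact ⟨(div_le_one hh0).2 e1, (lt_div_iff₀ hh0).2 e2⟩)
    refine ⟨R', fun _ _ => ⟨fun a ha => ?_, ?_⟩⟩
    · obtain ⟨g1, g2⟩ := h1 a ha
      refine ⟨fun x hx => ?_, fun x hx x' hx' => ?_⟩
      · rw [cellAverage_succ TY (hint x hx.2)]
        exact g1 x hx
      · rw [cellAverage_succ TY (hint x hx.2), cellAverage_succ TY (hint x' hx'.2)]
        exact g2 x hx x' hx'
    · rw [TX.sum_measureReal_children] at h2
      exact h2
  choose R' hR' using hlocal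
  refine ⟨fun a y => R' (TX.proj (i + 1) a) y a, fun a ha y hy => ?_, ?_⟩
  · exact (hR' _ y (TX.proj_mem _ _) hy).1 a (TX.mem_children.2 ⟨ha, rfl⟩)
  · have hη : 0 ≤ (CX ^ N)⁻¹ * (CY ^ N)⁻¹ * τ ^ 2 := by positivity
    rw [← TX.sum_children i]
    calc ∑ t ∈ TX.net (i + 1), ∑ a ∈ TX.children i t, ∑ y ∈ TY.net (j + 1),
          μX.real (TX.cell i a) * (μY.real (TY.cell (j + 1) y) *
            R' (TX.proj (i + 1) a) y a ^ 2)
        = ∑ t ∈ TX.net (i + 1), ∑ y ∈ TY.net (j + 1), μY.real (TY.cell (j + 1) y) *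
            ∑ a ∈ TX.children i t, μX.real (TX.cell i a) * R' t y a ^ 2 := by
          refine Finset.sum_congr rfl fun t _ => ?_
          rw [Finset.sum_comm]
          refine Finset.sum_congr rfl fun y _ => ?_
          rw [Finset.mul_sum]
          refine Finset.sum_congr rfl fun a ha => ?_
          rw [(TX.mem_children.1 ha).2]
          ring
      _ ≤ ∑ t ∈ TX.net (i + 1), ∑ y ∈ TY.net (j + 1), μY.real (TY.cell (j + 1) y) *
            ((1 - (CX ^ N)⁻¹ * (CY ^ N)⁻¹ * τ ^ 2) * (μX.real (TX.cell (i + 1) t) *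
              ∑ b ∈ TY.children j y,
                μY.real (TY.cell j b) / μY.real (TY.cell (j + 1) y) * R t b ^ 2)) :=
          Finset.sum_le_sum fun t ht => Finset.sum_le_sum fun y hy =>
            mul_le_mul_of_nonneg_left (hR' t y ht hy).2 measureReal_nonneg
      _ = (1 - (CX ^ N)⁻¹ * (CY ^ N)⁻¹ * τ ^ 2) * ∑ t ∈ TX.net (i + 1), ∑ b ∈ TY.net j,
            μX.real (TX.cell (i + 1) t) * (μY.real (TY.cell j b) * R t b ^ 2) := by
          rw [Finset.mul_sum]
          refine Finset.sum_congr rfl fun t _ => ?_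
          rw [← TY.sum_children j, Finset.mul_sum]
          refine Finset.sum_congr rfl fun y hy => ?_
          have hW := (measureReal_cell_pos TY hsY hB hy).ne'
          simp only [Finset.mul_sum]
          refine Finset.sum_congr rfl fun b _ => ?_
          field_simp
      _ ≤ _ := by
          refine mul_le_mul_of_nonneg_left hM (sub_nonneg.2 ?_)
          -- A subcell of positive mass has at most the mass of its cell, so `CX ^ N ≥ 1`.
          obtain ⟨x, hx⟩ := Measure.nonempty_support (IsProbabilityMeasure.ne_zero μX)
          have ht := TX.label_mem_net (i + 1) x
          have hch : TX.label i x ∈ TX.children i (TX.label (i + 1) x) :=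
            TX.label_mem_children rfl
          have h1 := hdX _ _ hch
          have h2 : μX.real (TX.cell i (TX.label i x)) ≤
              μX.real (TX.cell (i + 1) (TX.label (i + 1) x)) :=
            measureReal_mono (TX.cell_subset_cell hch)
          have h3 := measureReal_cell_pos TX hsX hB (TX.label_mem_net i x)
          have h4 : 1 ≤ CX ^ N := by
            refine le_of_mul_le_mul_right ?_ h3
            linarith
          have h5 : (CX ^ N)⁻¹ ≤ 1 := inv_le_one_of_one_le₀ h4
          have h6 : (CY ^ N)⁻¹ ≤ 1 := inv_le_one_of_one_le₀ (one_le_pow₀ hCY)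
          have h7 : τ ^ 2 ≤ 1 := pow_le_one₀ K.nonneg_τ (by linarith [K.τ_le])
          exact mul_le_one₀ (mul_le_one₀ h5 (by positivity) h6) (by positivity) h7

/-! ### Energy at the first and the last scale -/

lemma sq_integral_norm_le {E : Type*} [MeasurableSpace E] {μ : Measure E} [IsFiniteMeasure μ]
    {f : E → ℂ} (hf : MemLp f 2 μ) :
    (∫ x, ‖f x‖ ∂μ) ^ 2 ≤ μ.real univ * ∫ x, ‖f x‖ ^ 2 ∂μ := by
  have h1 : Integrable (fun x => ‖f x‖) μ := (hf.integrable one_le_two).norm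
  have h2 : Integrable (fun x => ‖f x‖ ^ 2) μ := hf.integrable_norm_pow two_ne_zero
  set a := ∫ x, ‖f x‖ ∂μ with ha
  set m := μ.real univ with hm
  have h3 : ∫ x, (m * ‖f x‖ - a) ^ 2 ∂μ = m * (m * (∫ x, ‖f x‖ ^ 2 ∂μ) - a ^ 2) := by
    have e : ∀ x, (m * ‖f x‖ - a) ^ 2 = m ^ 2 * ‖f x‖ ^ 2 - 2 * m * a * ‖f x‖ + a ^ 2 := by
      intro x; ring
    simp_rw [e]
    have h5 : Integrable (fun x => m ^ 2 * ‖f x‖ ^ 2 - 2 * m * a * ‖f x‖) μ :=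
      (h2.const_mul _).sub (h1.const_mul _)
    rw [integral_add h5 (integrable_const _),
      integral_sub (h2.const_mul _) (h1.const_mul _), integral_const_mul, integral_const_mul,
      integral_const, ← ha, ← hm, smul_eq_mul]
    ring
  have h4 : 0 ≤ m * (m * (∫ x, ‖f x‖ ^ 2 ∂μ) - a ^ 2) :=
    h3 ▸ integral_nonneg fun x => sq_nonneg _
  rcases (measureReal_nonneg : 0 ≤ μ.real univ).eq_or_lt with h0 | h0
  · have hμ : μ = 0 := by
      rw [← Measure.measure_univ_eq_zero]
      exact (measureReal_eq_zero_iff).1 h0.symm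
    have : a = 0 := by rw [ha, hμ, integral_zero_measure]
    simp [this, hμ]
  · have := nonneg_of_mul_nonneg_right h4 (hm ▸ h0)
    linarith

section Energy

variable {d : ℕ} {μX μY : Measure (Euc d)} [IsProbabilityMeasure μX] [IsProbabilityMeasure μY]
  {Φ : Euc d × Euc d → ℝ} {p : Euc d × Euc d → ℂ} {f : Euc d → ℂ} {A h B sX sY P : ℝ}

/-- At unit scale in `x` and at the finest scale in `y` there is no cancellation yet, and the energy
is at most the squared `L²` norm. -/
lemma hasEnergyBound_initial
    (hΦ : ∀ x ∈ μX.support, ∀ x' ∈ μX.support, ∀ y ∈ μY.support, ∀ y' ∈ μY.support,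
      |Φ (x, y) - Φ (x', y) - Φ (x, y') + Φ (x', y')| ≤ A * dist x x' * dist y y')
    (hint : ∀ x ∈ μX.support, Integrable (oscIntegrand Φ p h f x) μY)
    (hp : ∀ x ∈ μX.support, ∀ y ∈ μY.support, ‖p (x, y)‖ ≤ P)
    (hp' : ∀ x ∈ μX.support, ∀ x' ∈ μX.support, ∀ y ∈ μY.support,
      ‖p (x, y) - p (x', y)‖ ≤ P * dist x x')
    (hf : MemLp f 2 μY) (hP : 0 ≤ P) (hA : 1 ≤ A) (hB : 8 < B)
    (hsX : 0 < sX) (hsY : 0 < sY)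
    (TX : NetTower μX.support sX B) (TY : NetTower μY.support sY B) {i : ℕ}
    (hh : sX * B ^ i * sY = h) (hX1 : sX * B ^ i ≤ 1) :
    HasEnergyBound μX μY TX TY (fun j y => cellAverage Φ p h μY f (TY.cell j y) y) A i 0
      (P ^ 2 * ∫ y, ‖f y‖ ^ 2 ∂μY) := by
  have hB0 : 0 < B := by linarith
  have hρ : 0 < sX * B ^ i := mul_pos hsX (pow_pos hB0 _)
  have hh0 : 0 < h := hh ▸ mul_pos hρ hsY
  have hf1 : Integrable f μY := hf.integrable one_le_two
  have hae := Measure.support_mem_ae (μ := μY)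
  refine ⟨fun _ y => P * ((μY.real (TY.cell 0 y))⁻¹ * ∫ z in TY.cell 0 y, ‖f z‖ ∂μY),
    fun t ht y hy => ?_, ?_⟩
  · have hW := measureReal_cell_pos TY hsY hB hy
    have haeJ : ∀ᵐ z ∂μY.restrict (TY.cell 0 y), z ∈ TY.cell 0 y ∩ μY.support := by
      filter_upwards [ae_restrict_mem (TY.measurableSet_cell 0 y), ae_restrict_of_ae hae]
        with z h1 h2 using ⟨h1, h2⟩
    have hWn : ‖(μY.real (TY.cell 0 y) : ℂ)⁻¹‖ = (μY.real (TY.cell 0 y))⁻¹ := by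
      rw [norm_inv, Complex.norm_real, Real.norm_eq_abs, abs_of_pos hW]
    refine ⟨fun x hx => ?_, fun x hx x' hx' => ?_⟩
    · have h1 : ‖∫ z in TY.cell 0 y, oscIntegrand Φ p h f x z ∂μY‖ ≤
          ∫ z in TY.cell 0 y, P * ‖f z‖ ∂μY := by
        refine norm_integral_le_of_norm_le (hf1.norm.const_mul P).integrableOn ?_
        filter_upwards [haeJ] with z hz
        rw [oscIntegrand, norm_mul, norm_mul, norm_exp_I_mul_ofReal, one_mul]
        exact mul_le_mul_of_nonneg_right (hp x hx.2 z hz.2) (norm_nonneg _)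
      rw [integral_const_mul] at h1
      simp only [cellAverage]
      rw [norm_mul, norm_mul, norm_exp_I_mul_ofReal, one_mul, hWn]
      calc _ ≤ (μY.real (TY.cell 0 y))⁻¹ * (P * ∫ z in TY.cell 0 y, ‖f z‖ ∂μY) :=
            mul_le_mul_of_nonneg_left h1 (by positivity)
        _ = _ := by ring
    · have hdiff : Complex.exp (Complex.I * ((-(Φ (x, y) / h) : ℝ) : ℂ)) *
            (∫ z in TY.cell 0 y, oscIntegrand Φ p h f x z ∂μY) -
          Complex.exp (Complex.I * ((-(Φ (x', y) / h) : ℝ) : ℂ)) *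
            (∫ z in TY.cell 0 y, oscIntegrand Φ p h f x' z ∂μY) =
          ∫ z in TY.cell 0 y,
            (Complex.exp (Complex.I * ((-(Φ (x, y) / h) : ℝ) : ℂ)) * oscIntegrand Φ p h f x z -
            Complex.exp (Complex.I * ((-(Φ (x', y) / h) : ℝ) : ℂ)) *
              oscIntegrand Φ p h f x' z) ∂μY := by
        rw [integral_sub ((hint x hx.2).const_mul _).integrableOn
          ((hint x' hx'.2).const_mul _).integrableOn, integral_const_mul, integral_const_mul]
      have h1 : ‖∫ z in TY.cell 0 y,
            (Complex.exp (Complex.I * ((-(Φ (x, y) / h) : ℝ) : ℂ)) * oscIntegrand Φ p h f x z -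
            Complex.exp (Complex.I * ((-(Φ (x', y) / h) : ℝ) : ℂ)) *
              oscIntegrand Φ p h f x' z) ∂μY‖ ≤
          ∫ z in TY.cell 0 y, P * (4 * A / (sX * B ^ i)) * dist x x' * ‖f z‖ ∂μY := by
        refine norm_integral_le_of_norm_le (hf1.norm.const_mul _).integrableOn ?_
        filter_upwards [haeJ] with z hz
        have e : ∀ u : Euc d, Complex.exp (Complex.I * ((-(Φ (u, y) / h) : ℝ) : ℂ)) *
            oscIntegrand Φ p h f u z =
            Complex.exp (Complex.I * (((Φ (u, z) - Φ (u, y)) / h : ℝ) : ℂ)) * p (u, z) * f z := by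
          intro u
          rw [oscIntegrand, ← mul_assoc, ← mul_assoc, ← Complex.exp_add, ← mul_add,
            ← Complex.ofReal_add]
          congr 5
          ring
        rw [e, e, ← sub_mul, norm_mul]
        refine mul_le_mul_of_nonneg_right ?_ (norm_nonneg _)
        have e1 : Complex.exp (Complex.I * (((Φ (x, z) - Φ (x, y)) / h : ℝ) : ℂ)) * p (x, z) -
            Complex.exp (Complex.I * (((Φ (x', z) - Φ (x', y)) / h : ℝ) : ℂ)) * p (x', z) =
            (Complex.exp (Complex.I * (((Φ (x, z) - Φ (x, y)) / h : ℝ) : ℂ)) -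
              Complex.exp (Complex.I * (((Φ (x', z) - Φ (x', y)) / h : ℝ) : ℂ))) * p (x, z) +
            Complex.exp (Complex.I * (((Φ (x', z) - Φ (x', y)) / h : ℝ) : ℂ)) *
              (p (x, z) - p (x', z)) := by ring
        rw [e1]
        refine (norm_add_le _ _).trans ?_
        rw [norm_mul, norm_mul, norm_exp_I_mul_ofReal, one_mul]
        have hphase : |(Φ (x, z) - Φ (x, y)) / h - (Φ (x', z) - Φ (x', y)) / h| ≤
            2 * A / (sX * B ^ i) * dist x x' := by
          have e2 : (Φ (x, z) - Φ (x, y)) / h - (Φ (x', z) - Φ (x', y)) / h =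
              (Φ (x, z) - Φ (x', z) - Φ (x, y) + Φ (x', y)) / h := by ring
          rw [e2, abs_div, abs_of_pos hh0, div_le_iff₀ hh0]
          have e3 := hΦ x hx.2 x' hx'.2 z hz.2 y (TY.mem_of_mem_net hy)
          have e4 := TY.dist_le_of_mem_cell hsY.le (by linarith) hz.2 hz.1
          rw [pow_zero, mul_one] at e4
          have e5 : 2 * A / (sX * B ^ i) * dist x x' * h = A * dist x x' * (2 * sY) := by
            rw [← hh]; field_simp
          rw [e5]
          exact e3.trans (mul_le_mul_of_nonneg_left e4
            (mul_nonneg (by linarith) dist_nonneg))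
        have t1 := mul_le_mul ((norm_exp_sub_exp_le _ _).trans hphase) (hp x hx.2 z hz.2)
          (norm_nonneg _) (mul_nonneg (by positivity) dist_nonneg)
        have t2 := hp' x hx.2 x' hx'.2 z hz.2
        have t3 : 1 ≤ 2 * A / (sX * B ^ i) := by
          rw [le_div_iff₀ hρ]; linarith
        have t4 : P * dist x x' ≤ 2 * A / (sX * B ^ i) * (P * dist x x') :=
          le_mul_of_one_le_left (mul_nonneg hP dist_nonneg) t3
        have t5 : P * (4 * A / (sX * B ^ i)) * dist x x' =
          2 * A / (sX * B ^ i) * dist x x' * P + 2 * A / (sX * B ^ i) * (P * dist x x') := by ring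
        rw [t5]
        linarith
      rw [integral_const_mul] at h1
      simp only [cellAverage]
      rw [← mul_sub, hdiff, norm_mul, hWn]
      calc _ ≤ (μY.real (TY.cell 0 y))⁻¹ * (P * (4 * A / (sX * B ^ i)) * dist x x' *
              ∫ z in TY.cell 0 y, ‖f z‖ ∂μY) :=
            mul_le_mul_of_nonneg_left h1 (by positivity)
        _ = _ := by ring
  · have hterm : ∀ y ∈ TY.net 0, μY.real (TY.cell 0 y) *
        (P * ((μY.real (TY.cell 0 y))⁻¹ * ∫ z in TY.cell 0 y, ‖f z‖ ∂μY)) ^ 2 ≤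
        P ^ 2 * ∫ z in TY.cell 0 y, ‖f z‖ ^ 2 ∂μY := by
      intro y hy
      have hW := measureReal_cell_pos TY hsY hB hy
      have h1 := sq_integral_norm_le (hf.restrict (TY.cell 0 y))
      rw [measureReal_restrict_apply_univ] at h1
      have e : μY.real (TY.cell 0 y) *
        (P * ((μY.real (TY.cell 0 y))⁻¹ * ∫ z in TY.cell 0 y, ‖f z‖ ∂μY)) ^ 2 =
        P ^ 2 * ((∫ z in TY.cell 0 y, ‖f z‖ ∂μY) ^ 2 / μY.real (TY.cell 0 y)) := by
        field_simp
      rw [e]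
      refine mul_le_mul_of_nonneg_left ?_ (sq_nonneg _)
      rw [div_le_iff₀ hW]
      linarith
    simp_rw [← Finset.mul_sum]
    rw [← Finset.sum_mul, TX.sum_measureReal_net, one_mul,
      ← TY.sum_setIntegral_net (hf.integrable_norm_pow two_ne_zero) 0, Finset.mul_sum]
    exact Finset.sum_le_sum hterm

/-- At the finest scale in `x` the energy controls the squared `L²` norm of the oscillatory
integral. -/
lemma HasEnergyBound.integral_norm_sq_le {TX : NetTower μX.support sX B}
    {TY : NetTower μY.support sY B} {j : ℕ} {M : ℝ} (hsY : 0 < sY) (hB : 8 < B)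
    (hE : HasEnergyBound μX μY TX TY
      (fun j y => cellAverage Φ p h μY f (TY.cell j y) y) A 0 j M)
    (hint : ∀ x ∈ μX.support, Integrable (oscIntegrand Φ p h f x) μY)
    (hint2 : Integrable (fun x => ‖∫ z, oscIntegrand Φ p h f x z ∂μY‖ ^ 2) μX) :
    ∫ x, ‖∫ z, oscIntegrand Φ p h f x z ∂μY‖ ^ 2 ∂μX ≤ M := by
  obtain ⟨R, hR, hM⟩ := hE
  refine le_trans ?_ hM
  rw [← TX.sum_setIntegral_net hint2 0]
  refine Finset.sum_le_sum fun t ht => ?_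
  have hpt : ∀ x ∈ TX.cell 0 t ∩ μX.support, ‖∫ z, oscIntegrand Φ p h f x z ∂μY‖ ^ 2 ≤
      ∑ y ∈ TY.net j, μY.real (TY.cell j y) * R t y ^ 2 := by
    intro x hx
    have h1 : ‖∫ z, oscIntegrand Φ p h f x z ∂μY‖ ≤
        ∑ y ∈ TY.net j, μY.real (TY.cell j y) * R t y := by
      rw [← TY.sum_setIntegral_net (hint x hx.2) j]
      refine norm_sum_le_of_le _ fun y hy => ?_
      have hW := measureReal_cell_pos TY hsY hB hy
      have h2 := (hR t ht y hy).1 x hx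
      simp only [cellAverage] at h2
      rw [norm_mul, norm_mul, norm_exp_I_mul_ofReal, one_mul, norm_inv, Complex.norm_real,
        Real.norm_eq_abs, abs_of_pos hW, inv_mul_le_iff₀ hW] at h2
      exact h2
    refine (pow_le_pow_left₀ (norm_nonneg _) h1 2).trans ?_
    simpa using (even_two.convexOn_pow (𝕜 := ℝ)).map_sum_le (t := TY.net j)
      (w := fun y => μY.real (TY.cell j y)) (p := R t) (fun _ _ => measureReal_nonneg)
      (TY.sum_measureReal_net μY j) (fun _ _ => mem_univ _)
  calc ∫ x in TX.cell 0 t, ‖∫ z, oscIntegrand Φ p h f x z ∂μY‖ ^ 2 ∂μX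
      ≤ ∫ _x in TX.cell 0 t, ∑ y ∈ TY.net j, μY.real (TY.cell j y) * R t y ^ 2 ∂μX := by
        refine integral_mono_ae hint2.integrableOn (integrable_const _) ?_
        filter_upwards [ae_restrict_mem (TX.measurableSet_cell 0 t),
          ae_restrict_of_ae (Measure.support_mem_ae (μ := μX))] with x h1 h2 using hpt x ⟨h1, h2⟩
    _ = ∑ y ∈ TY.net j, μX.real (TX.cell 0 t) * (μY.real (TY.cell j y) * R t y ^ 2) := by
        rw [integral_const, measureReal_restrict_apply_univ, smul_eq_mul, Finset.mul_sum]

/-- Exponential decay of the oscillatory integral in the number of scales between `h` and `1`. -/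
lemma integral_norm_sq_oscIntegral_le (hd : 1 ≤ d) {c ξ Z τ CX CY : ℝ} {N m : ℕ}
    (K : StepConstants A c B ξ Z τ)
    (hΦ : ∀ x ∈ μX.support, ∀ x' ∈ μX.support, ∀ y ∈ μY.support, ∀ y' ∈ μY.support,
      |Φ (x, y) - Φ (x', y) - Φ (x, y') + Φ (x', y')| ≤ A * dist x x' * dist y y')
    (hN : IsNonorthogonal Φ μX.support μY.support c h h 1 1)
    (hDX : IsDoubling μX h CX) (hDY : IsDoubling μY h CY) (hCY : 1 ≤ CY)
    (hXb : TotallyBounded μX.support) (hYb : TotallyBounded μY.support)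
    (hint : ∀ x ∈ μX.support, Integrable (oscIntegrand Φ p h f x) μY)
    (hint2 : Integrable (fun x => ‖∫ z, oscIntegrand Φ p h f x z ∂μY‖ ^ 2) μX)
    (hp : ∀ x ∈ μX.support, ∀ y ∈ μY.support, ‖p (x, y)‖ ≤ P)
    (hp' : ∀ x ∈ μX.support, ∀ x' ∈ μX.support, ∀ y ∈ μY.support,
      ‖p (x, y) - p (x', y)‖ ≤ P * dist x x')
    (hf : MemLp f 2 μY) (hP : 0 ≤ P) (hh0 : 0 < h) (hm : h * B ^ (m + 2) ≤ 1)
    (hN1 : 24 * d * B ≤ 2 ^ N) (hN2 : 2 ^ N ≤ 4 * d * B ^ 2) (hdB : 4 * d ≤ B) :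
    ∫ x, ‖∫ z, oscIntegrand Φ p h f x z ∂μY‖ ^ 2 ∂μX ≤
      (1 - (CX ^ N)⁻¹ * (CY ^ N)⁻¹ * τ ^ 2) ^ m * (P ^ 2 * ∫ y, ‖f y‖ ^ 2 ∂μY) := by
  have hB := K.lt_B
  have hB0 : 0 < B := by linarith
  have hsX : 0 < (B ^ (m + 1))⁻¹ := inv_pos.2 (pow_pos hB0 _)
  have hsY : 0 < h * B := mul_pos hh0 hB0
  obtain ⟨TX⟩ := nonempty_netTower hXb
    (Measure.nonempty_support (IsProbabilityMeasure.ne_zero μX)) hsX hB0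
  obtain ⟨TY⟩ := nonempty_netTower hYb
    (Measure.nonempty_support (IsProbabilityMeasure.ne_zero μY)) hsY hB0
  have hind : ∀ j i : ℕ, i + j = m → HasEnergyBound μX μY TX TY
      (fun j y => cellAverage Φ p h μY f (TY.cell j y) y) A i j
      ((1 - (CX ^ N)⁻¹ * (CY ^ N)⁻¹ * τ ^ 2) ^ j * (P ^ 2 * ∫ y, ‖f y‖ ^ 2 ∂μY)) := by
    intro j
    induction j with
    | zero =>
      intro i hi
      rw [pow_zero, one_mul]
      have him : i = m := hi
      refine hasEnergyBound_initial hΦ hint hp hp' hf hP K.one_le_A hB hsX hsY TX TY ?_ ?_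
      · rw [him, pow_succ]; field_simp
      · rw [him, inv_mul_le_iff₀ (pow_pos hB0 _), mul_one]
        exact pow_le_pow_right₀ (by linarith) (Nat.le_succ m)
    | succ j ih =>
      intro i hi
      have hprev := ih (i + 1) (by omega)
      have := hprev.step hd K hΦ hN hDX hDY hCY hint hsX hsY TX TY (N := N) ?_ ?_ ?_ hN1 hN2 hdB
      · rwa [← mul_assoc, ← pow_succ'] at this
      · have : B ^ (m + 1) = B ^ (i + 1) * B ^ j * B := by
          rw [← pow_add, ← pow_succ]; congr 1; omega
        rw [this]; field_simp
      · rw [mul_assoc, ← pow_succ, inv_mul_le_iff₀ (pow_pos hB0 _), mul_one]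
        exact pow_le_pow_right₀ (by linarith) (by omega)
      · refine le_trans ?_ hm
        have : h * B * B ^ (j + 1) * B = h * B ^ (j + 3) := by ring
        rw [this]
        exact mul_le_mul_of_nonneg_left (pow_le_pow_right₀ (by linarith) (by omega)) hh0.le
  exact (hind m 0 (by omega)).integral_norm_sq_le hsY hB hint hint2

end Energy

/-! ### The oscillatory integral operator -/

section Operator

variable {d : ℕ} {μX μY : Measure (Euc d)} {U V : Set (Euc d)}
  {Φ : Euc d × Euc d → ℝ} {p : Euc d × Euc d → ℂ} {h P : ℝ}

lemma semiclassicalFIO_eq_integral (μ : Measure (Euc d)) (f : Euc d → ℂ) (x : Euc d) :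
    semiclassicalFIO Φ p h μ f x = ∫ z, oscIntegrand Φ p h f x z ∂μ := by
  have hae : ∀ᵐ z ∂μ, z ∈ μ.support := Measure.support_mem_ae
  rw [semiclassicalFIO, Measure.restrict_eq_self_of_ae_mem hae]
  rfl

lemma integrable_oscIntegrand (hYV : μY.support ⊆ V) (hV : MeasurableSet V)
    (hΦ : ContinuousOn Φ (U ×ˢ V)) (hp : ContinuousOn p (U ×ˢ V))
    (hP : ∀ x ∈ U, ∀ y ∈ V, ‖p (x, y)‖ ≤ P) {f : Euc d → ℂ} (hf : Integrable f μY)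
    {x : Euc d} (hx : x ∈ U) : Integrable (oscIntegrand Φ p h f x) μY := by
  have hae : ∀ᵐ z ∂μY, z ∈ V := by
    filter_upwards [Measure.support_mem_ae (μ := μY)] with z hz using hYV hz
  have hmaps : MapsTo (fun z => (x, z)) V (U ×ˢ V) := fun z hz => ⟨hx, hz⟩
  have hpair : ContinuousOn (fun z : Euc d => (x, z)) V := by fun_prop
  have h1 : ContinuousOn (fun z => Φ (x, z)) V := hΦ.comp hpair hmaps
  have h2 : ContinuousOn (fun z => p (x, z)) V := hp.comp hpair hmaps
  have hcont : ContinuousOn (fun z =>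
      Complex.exp (Complex.I * ((Φ (x, z) / h : ℝ) : ℂ)) * p (x, z)) V := by
    refine ContinuousOn.mul (Complex.continuous_exp.comp_continuousOn
      (continuousOn_const.mul (Complex.continuous_ofReal.comp_continuousOn (h1.div_const h)))) h2
  have hmeas := hcont.aestronglyMeasurable (μ := μY) hV
  rw [Measure.restrict_eq_self_of_ae_mem hae] at hmeas
  refine hf.bdd_mul (c := P) hmeas ?_
  filter_upwards [hae] with z hz
  rw [norm_mul, norm_exp_I_mul_ofReal, one_mul]
  exact hP x hx z hz

lemma continuousOn_integral_oscIntegrand (hYV : μY.support ⊆ V) (hV : MeasurableSet V)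
    (hΦ : ContinuousOn Φ (U ×ˢ V)) (hp : ContinuousOn p (U ×ˢ V))
    (hP : ∀ x ∈ U, ∀ y ∈ V, ‖p (x, y)‖ ≤ P) {f : Euc d → ℂ} (hf : Integrable f μY) :
    ContinuousOn (fun x => ∫ z, oscIntegrand Φ p h f x z ∂μY) U := by
  have hae : ∀ᵐ z ∂μY, z ∈ V := by
    filter_upwards [Measure.support_mem_ae (μ := μY)] with z hz using hYV hz
  refine continuousOn_of_dominated (bound := fun z => P * ‖f z‖)
    (fun x hx => (integrable_oscIntegrand hYV hV hΦ hp hP hf hx).aestronglyMeasurable)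
    (fun x hx => ?_) (hf.norm.const_mul P) ?_
  · filter_upwards [hae] with z hz
    rw [oscIntegrand, norm_mul, norm_mul, norm_exp_I_mul_ofReal, one_mul]
    exact mul_le_mul_of_nonneg_right (hP x hx z hz) (norm_nonneg _)
  · filter_upwards [hae] with z hz
    have hmaps : MapsTo (fun x => (x, z)) U (U ×ˢ V) := fun x hx => ⟨hx, hz⟩
    have hpair : ContinuousOn (fun x : Euc d => (x, z)) U := by fun_prop
    have h1 : ContinuousOn (fun x => Φ (x, z)) U := hΦ.comp hpair hmaps
    have h2 : ContinuousOn (fun x => p (x, z)) U := hp.comp hpair hmaps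
    exact ((Complex.continuous_exp.comp_continuousOn
      (continuousOn_const.mul (Complex.continuous_ofReal.comp_continuousOn
        (h1.div_const h)))).mul h2).mul continuousOn_const

lemma norm_integral_oscIntegrand_le (hYV : μY.support ⊆ V)
    (hP : ∀ x ∈ U, ∀ y ∈ V, ‖p (x, y)‖ ≤ P) {f : Euc d → ℂ} (hf : Integrable f μY)
    {x : Euc d} (hx : x ∈ U) :
    ‖∫ z, oscIntegrand Φ p h f x z ∂μY‖ ≤ P * ∫ z, ‖f z‖ ∂μY := by
  rw [← integral_const_mul]
  refine norm_integral_le_of_norm_le (hf.norm.const_mul P) ?_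
  filter_upwards [Measure.support_mem_ae (μ := μY)] with z hz
  rw [oscIntegrand, norm_mul, norm_mul, norm_exp_I_mul_ofReal, one_mul]
  exact mul_le_mul_of_nonneg_right (hP x hx z (hYV hz)) (norm_nonneg _)

lemma memLp_integral_oscIntegrand [IsFiniteMeasure μX] (hXU : μX.support ⊆ U) (hYV : μY.support ⊆ V)
    (hU : MeasurableSet U) (hV : MeasurableSet V)
    (hΦ : ContinuousOn Φ (U ×ˢ V)) (hp : ContinuousOn p (U ×ˢ V))
    (hP : ∀ x ∈ U, ∀ y ∈ V, ‖p (x, y)‖ ≤ P) {f : Euc d → ℂ} (hf : Integrable f μY) :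
    MemLp (fun x => ∫ z, oscIntegrand Φ p h f x z ∂μY) 2 μX := by
  have hae : ∀ᵐ x ∂μX, x ∈ U := by
    filter_upwards [Measure.support_mem_ae (μ := μX)] with z hz using hXU hz
  have hmeas := (continuousOn_integral_oscIntegrand (h := h) hYV hV hΦ hp hP
    hf).aestronglyMeasurable (μ := μX) hU
  rw [Measure.restrict_eq_self_of_ae_mem hae] at hmeas
  refine MemLp.of_bound hmeas (P * ∫ z, ‖f z‖ ∂μY) ?_
  filter_upwards [hae] with x hx using norm_integral_oscIntegrand_le hYV hP hf hx

lemma integral_norm_sq_le_of_bound [IsProbabilityMeasure μX] [IsProbabilityMeasure μY]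
    (hXU : μX.support ⊆ U) (hYV : μY.support ⊆ V)
    (hP : ∀ x ∈ U, ∀ y ∈ V, ‖p (x, y)‖ ≤ P) {f : Euc d → ℂ} (hf : MemLp f 2 μY)
    (hint2 : Integrable (fun x => ‖∫ z, oscIntegrand Φ p h f x z ∂μY‖ ^ 2) μX) :
    ∫ x, ‖∫ z, oscIntegrand Φ p h f x z ∂μY‖ ^ 2 ∂μX ≤ P ^ 2 * ∫ y, ‖f y‖ ^ 2 ∂μY := by
  have h1 : ∫ x, ‖∫ z, oscIntegrand Φ p h f x z ∂μY‖ ^ 2 ∂μX ≤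
      ∫ _x, (P * ∫ z, ‖f z‖ ∂μY) ^ 2 ∂μX := by
    refine integral_mono_ae hint2 (integrable_const _) ?_
    filter_upwards [Measure.support_mem_ae (μ := μX)] with x hx
    exact pow_le_pow_left₀ (norm_nonneg _)
      (norm_integral_oscIntegrand_le hYV hP (hf.integrable one_le_two) (hXU hx)) 2
  refine h1.trans ?_
  have h2 := sq_integral_norm_le hf
  rw [probReal_univ, one_mul] at h2
  rw [integral_const, probReal_univ, one_smul, mul_pow]
  exact mul_le_mul_of_nonneg_left h2 (sq_nonneg _)

lemma norm_sq_eq_integral {E : Type*} [MeasurableSpace E] {μ : Measure E} (f : Lp ℂ 2 μ) :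
    ‖f‖ ^ 2 = ∫ x, ‖f x‖ ^ 2 ∂μ := by
  have h1 : (inner ℂ f f : ℂ) = ((∫ x, ‖f x‖ ^ 2 ∂μ : ℝ) : ℂ) := by
    rw [L2.inner_def, ← integral_complex_ofReal]
    refine integral_congr_ae (Filter.Eventually.of_forall fun x => ?_)
    simp [inner_self_eq_norm_sq_to_K]
  rw [inner_self_eq_norm_sq_to_K] at h1
  exact Complex.ofReal_injective (by simpa using h1)

/-- An `L²` bound for the oscillatory integrals of all `L²` functions yields a bounded operator. -/
lemma exists_clm_of_integral_norm_sq_le [IsFiniteMeasure μX] [IsFiniteMeasure μY]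
    (hXU : μX.support ⊆ U) (hYV : μY.support ⊆ V)
    (hU : MeasurableSet U) (hV : MeasurableSet V)
    (hΦ : ContinuousOn Φ (U ×ˢ V)) (hp : ContinuousOn p (U ×ˢ V))
    (hP : ∀ x ∈ U, ∀ y ∈ V, ‖p (x, y)‖ ≤ P) {M : ℝ} (hM : 0 ≤ M)
    (hbound : ∀ f : Euc d → ℂ, MemLp f 2 μY →
      ∫ x, ‖∫ z, oscIntegrand Φ p h f x z ∂μY‖ ^ 2 ∂μX ≤ M ^ 2 * ∫ y, ‖f y‖ ^ 2 ∂μY) :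
    ∃ T : Lp ℂ 2 μY →L[ℂ] Lp ℂ 2 μX,
      (∀ f : Lp ℂ 2 μY, T f =ᵐ[μX] semiclassicalFIO Φ p h μY f) ∧ ‖T‖ ≤ M := by
  have hint : ∀ f : Lp ℂ 2 μY, Integrable f μY := fun f => (Lp.memLp f).integrable one_le_two
  have hmem : ∀ f : Lp ℂ 2 μY, MemLp (fun x => ∫ z, oscIntegrand Φ p h f x z ∂μY) 2 μX :=
    fun f => memLp_integral_oscIntegrand hXU hYV hU hV hΦ hp hP (hint f)
  have hae : ∀ᵐ x ∂μX, x ∈ U := by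
    filter_upwards [Measure.support_mem_ae (μ := μX)] with z hz using hXU hz
  let T₀ : Lp ℂ 2 μY →ₗ[ℂ] Lp ℂ 2 μX :=
    { toFun := fun f => (hmem f).toLp _
      map_add' := fun f g => by
        rw [← MemLp.toLp_add, MemLp.toLp_eq_toLp_iff]
        filter_upwards [hae] with x hx
        rw [Pi.add_apply, ← integral_add (integrable_oscIntegrand hYV hV hΦ hp hP (hint f) hx)
          (integrable_oscIntegrand hYV hV hΦ hp hP (hint g) hx)]
        refine integral_congr_ae ?_
        filter_upwards [Lp.coeFn_add f g] with z hz
        rw [oscIntegrand, hz, Pi.add_apply, mul_add]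
        rfl
      map_smul' := fun c f => by
        rw [RingHom.id_apply, ← MemLp.toLp_const_smul, MemLp.toLp_eq_toLp_iff]
        filter_upwards [hae] with x hx
        rw [Pi.smul_apply, ← integral_smul]
        refine integral_congr_ae ?_
        filter_upwards [Lp.coeFn_smul c f] with z hz
        rw [oscIntegrand, hz, Pi.smul_apply, mul_smul_comm]
        rfl }
  have hT₀ : ∀ f, ‖T₀ f‖ ≤ M * ‖f‖ := by
    intro f
    refine le_of_abs_le (abs_le_of_sq_le_sq ?_ (by positivity))
    rw [mul_pow, norm_sq_eq_integral, norm_sq_eq_integral]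
    refine le_trans (le_of_eq (integral_congr_ae ?_)) (hbound f (Lp.memLp f))
    filter_upwards [(hmem f).coeFn_toLp] with x hx
    change ‖((hmem f).toLp _) x‖ ^ 2 = _
    rw [hx]
  refine ⟨T₀.mkContinuous M hT₀, fun f => ?_, T₀.mkContinuous_norm_le hM hT₀⟩
  filter_upwards [(hmem f).coeFn_toLp] with x hx
  rw [semiclassicalFIO_eq_integral]
  exact hx

end Operator

/-- For `h > 1 / 2` the range of side lengths `[h, 1 / 2]` is empty and the constant of a doubling
measure may be below `1`. -/
lemma IsDoubling.one_le {d : ℕ} {μ : Measure (Euc d)} [IsProbabilityMeasure μ] {h C : ℝ}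
    (hμ : IsDoubling μ h C) (hh : 0 < h) (hh2 : h ≤ 1 / 2) : 1 ≤ C := by
  obtain ⟨x, hx⟩ := Measure.nonempty_support (IsProbabilityMeasure.ne_zero μ)
  have h1 := hμ.2 h ⟨le_rfl, hh2⟩ x hx
  have hsub : cube x h ⊆ cube x (2 * h) := fun y hy i => (hy i).trans (by linarith)
  have hpos : 0 < μ (cube x h) := by
    refine (Measure.mem_support_iff_forall _).1 hx _
      (Filter.mem_of_superset (Metric.ball_mem_nhds x (half_pos hh)) fun y hy => ?_)
    exact mem_cube_of_dist_le (Metric.mem_ball.1 hy).le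
  have h2 := (measure_mono hsub).trans h1
  by_contra! hC
  have h3 : ENNReal.ofReal C * μ (cube x h) < 1 * μ (cube x h) :=
    ENNReal.mul_lt_mul_left hpos.ne' (measure_ne_top _ _) (by simpa using hC)
  rw [one_mul] at h3
  exact absurd h2 (not_le.2 h3)

/-! ### Numerical constants -/

section Constants

variable {d : ℕ} {c A : ℝ}

lemma baseL_eq (d : ℕ) (c A : ℝ) : baseL d c A = 10 ^ 14 * (d * max 1 A / c) ^ 3 := by
  have h : max 1 (A ^ 3) = max 1 A ^ 3 := by
    rcases le_total 1 A with hA | hA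
    · rw [max_eq_right hA, max_eq_right (one_le_pow₀ hA)]
    · rw [max_eq_left hA, one_pow, max_eq_left]
      have : Odd 3 := by decide
      simpa using this.strictMono_pow.monotone hA
  rw [baseL, h]
  ring

lemma stepConstants_baseL (hd : 1 ≤ d) (hc : 0 < c) (hc1 : c ≤ 1) :
    StepConstants (max 1 A) c (baseL d c A) (c / (12000 * max 1 A ^ 2)) (1000 * max 1 A / c)
      (c / (12000 * max 1 A)) := by
  rw [baseL_eq]
  have hd1 : (1 : ℝ) ≤ d := by exact_mod_cast hd
  have ha1 : 1 ≤ max 1 A := le_max_left _ _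
  generalize max 1 A = a at ha1
  have ha0 : 0 < a := by linarith
  set L := 10 ^ 14 * (d * a / c) ^ 3 with hL
  set r := a / c with hr
  have hr1 : 1 ≤ r := by rw [hr, le_div_iff₀ hc]; linarith
  have hLr : 10 ^ 14 * r ^ 3 ≤ L := by
    have : r ≤ d * a / c := by
      rw [hr, mul_div_assoc]
      exact le_mul_of_one_le_left (by positivity) hd1
    rw [hL]
    gcongr
  have hr2 : r ≤ r ^ 3 := le_self_pow₀ hr1 (by norm_num)
  have hL0 : 0 < L := by linarith [pow_pos (zero_lt_one.trans_le hr1) 3]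
  set ξ := c / (12000 * a ^ 2) with hξ
  have hξ0 : 0 < ξ := by positivity
  have hξa : ξ * a = c / (12000 * a) := by rw [hξ]; field_simp
  have hξr : a * (ξ * r) = 1 / 12000 := by rw [hξ, hr]; field_simp
  have hξ1 : ξ ≤ 1 / 12000 := by
    have : 1 ≤ a * r := one_le_mul_of_one_le_of_one_le ha1 hr1
    nlinarith
  have hZ : 1000 * a / c = 1000 * r := by rw [hr]; ring
  have hcr : c * r = a := by rw [hr]; field_simp
  rw [hZ, ← hξa]
  -- `L` is so large that even `Z / L` is small compared with `ξ`: displacements inside the cells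
  -- of the next scale are negligible.
  have hinv : 1000 * r / L ≤ ξ / 1000 := by
    rw [div_le_iff₀ hL0]
    have e1 : ξ * (12000 * a * r) = 1 := by linarith
    have har : a * r ≤ r ^ 2 := by
      have : a ≤ r := by rw [hr, le_div_iff₀ hc]; nlinarith
      nlinarith
    have e2 : 12000 * (a * r) * (1000 * 1000 * r) ≤ L := by
      have : a * r * r ≤ r ^ 3 := by nlinarith
      linarith [pow_pos (zero_lt_one.trans_le hr1) 3]
    have e3 := mul_le_mul_of_nonneg_left e2 hξ0.le
    have e4 : ξ * (12000 * (a * r) * (1000 * 1000 * r)) = 1000 * 1000 * r := by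
      linear_combination (1000 * 1000 * r) * e1
    linarith
  have hinv1 : 1 / L ≤ ξ / 1000000 := by
    have : 1000 * r / L = 1000 * r * (1 / L) := by ring
    have h2 : 0 < 1 / L := by positivity
    nlinarith
  have hinv8 : 8 / L ≤ ξ / 100000 := by
    have : 8 / L = 8 * (1 / L) := by ring
    linarith
  have hξa0 : 0 < ξ * a := by positivity
  refine ⟨ha1, by linarith, hξ0, by linarith, ?_, by linarith, by linarith, hξa0.le, ?_, ?_, ?_⟩
  · have h1 : 1 ≤ ξ * L := by
      rw [div_le_iff₀ hL0] at hinv1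
      nlinarith
    have h2 : 1 < L := by linarith
    nlinarith
  · have : ξ * a ≤ a * (ξ * r) := by nlinarith
    linarith
  · have h1 : 2 * ξ + 8 / L ≤ 3 * ξ := by linarith
    have h2 : 2 * (1000 * r) + 4 ≤ 2004 * r := by linarith
    calc a * (2 * ξ + 8 / L) * (2 * (1000 * r) + 4) ≤ a * (3 * ξ) * (2004 * r) := by gcongr
      _ = 6012 * (a * (ξ * r)) := by ring
      _ ≤ 1 := by rw [hξr]; norm_num
  · have h1 : 2 * ξ + 8 / L ≤ 21 / 10 * ξ := by linarith
    have h2 : 64 * a * (2 * ξ + 8 / L) ≤ 64 * a * (21 / 10 * ξ) := by gcongr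
    have h3 : c * ξ * (1000 * r) = 1000 * (ξ * a) := by rw [← hcr]; ring
    have h4 : 16 * a * (1000 * r) / L ≤ 16 * a * (ξ / 1000) := by
      rw [mul_div_assoc]; gcongr
    have h5 : 32 * a / L ≤ 32 * a * (ξ / 1000000) := by
      rw [div_eq_mul_one_div]; gcongr
    rw [h3]
    linarith

lemma baseL_facts (hd : 1 ≤ d) (hc : 0 < c) (hc1 : c ≤ 1) (A : ℝ) :
    10 ^ 14 ≤ baseL d c A ∧ 4 * (d : ℝ) ≤ baseL d c A ∧
    max 1 A ^ 2 ≤ baseL d c A ^ (2 / 3 : ℝ) ∧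
    24 * d * baseL d c A ≤ 2 ^ ⌈Real.logb 2 (20 * baseL d c A ^ (5 / 3 : ℝ))⌉₊ ∧
    (2 : ℝ) ^ ⌈Real.logb 2 (20 * baseL d c A ^ (5 / 3 : ℝ))⌉₊ ≤ 4 * d * baseL d c A ^ 2 := by
  have hd1 : (1 : ℝ) ≤ d := by exact_mod_cast hd
  have ha1 : 1 ≤ max 1 A := le_max_left _ _
  have hLeq := baseL_eq d c A
  set L := baseL d c A with hL
  generalize max 1 A = a at ha1 hLeq
  set q := d * a / c with hq
  have hq1 : 1 ≤ q := by
    rw [hq, le_div_iff₀ hc]; nlinarith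
  have hqd : d ≤ q := by
    rw [hq, le_div_iff₀ hc]; nlinarith
  have hqa : a ≤ q := by
    rw [hq, le_div_iff₀ hc]; nlinarith
  have hq3 : q ≤ q ^ 3 := le_self_pow₀ hq1 (by norm_num)
  have hL0 : 0 < L := by rw [hLeq]; positivity
  set l := L ^ (1 / 3 : ℝ) with hl
  have hl3 : L = l ^ 3 := by
    rw [hl, ← Real.rpow_natCast, ← Real.rpow_mul hL0.le]; norm_num
  have hl0 : 0 ≤ l := Real.rpow_nonneg hL0.le _
  have hlq : 20 * q ≤ l := by
    refine le_of_pow_le_pow_left₀ (n := 3) (by norm_num) hl0 ?_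
    rw [← hl3, hLeq, mul_pow]
    gcongr
    norm_num
  have hl5 : L ^ (5 / 3 : ℝ) = l ^ 5 := by
    rw [hl, ← Real.rpow_natCast, ← Real.rpow_mul hL0.le]; norm_num
  have hl2 : L ^ (2 / 3 : ℝ) = l ^ 2 := by
    rw [hl, ← Real.rpow_natCast, ← Real.rpow_mul hL0.le]; norm_num
  have hlpos : 0 < l := by linarith
  have harg : 1 ≤ 20 * l ^ 5 := by
    have : 1 ≤ l ^ 5 := one_le_pow₀ (by linarith)
    linarith
  have hlog0 : 0 ≤ Real.logb 2 (20 * l ^ 5) := Real.logb_nonneg one_lt_two harg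
  have hceil1 : 20 * l ^ 5 ≤ (2 : ℝ) ^ ⌈Real.logb 2 (20 * l ^ 5)⌉₊ := by
    have h1 := Real.rpow_le_rpow_of_exponent_le one_le_two
      (Nat.le_ceil (Real.logb 2 (20 * l ^ 5)))
    rwa [Real.rpow_natCast, Real.rpow_logb two_pos (by norm_num) (by linarith)] at h1
  have hceil2 : (2 : ℝ) ^ ⌈Real.logb 2 (20 * l ^ 5)⌉₊ ≤ 2 * (20 * l ^ 5) := by
    have h1 := (Nat.ceil_lt_add_one hlog0).le
    have h2 := Real.rpow_le_rpow_of_exponent_le one_le_two h1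
    rw [Real.rpow_natCast, Real.rpow_add two_pos, Real.rpow_logb two_pos (by norm_num)
      (by linarith), Real.rpow_one] at h2
    linarith
  rw [hl5, hl2]
  refine ⟨?_, ?_, ?_, le_trans ?_ hceil1, hceil2.trans ?_⟩
  · rw [hLeq]; nlinarith
  · rw [hLeq]; nlinarith
  · exact pow_le_pow_left₀ (by linarith) (by linarith) 2
  · have h1 : 24 * d ≤ 20 * l ^ 2 := by nlinarith
    rw [hl3]
    calc 24 * d * l ^ 3 ≤ 20 * l ^ 2 * l ^ 3 := by gcongr
      _ = 20 * l ^ 5 := by ring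
  · rw [hl3]
    have h1 : 40 ≤ 4 * d * l := by nlinarith
    calc 2 * (20 * l ^ 5) = 40 * l ^ 5 := by ring
      _ ≤ 4 * d * l * l ^ 5 := by gcongr
      _ = 4 * d * (l ^ 3) ^ 2 := by ring

end Constants

/-! ### Conclusion -/

lemma invExponentBound_pos {d : ℕ} {c A CX CY : ℝ} (hd : 1 ≤ d) (hc : 0 < c) (hc1 : c ≤ 1)
    (hCX : 0 < CX) (hCY : 0 < CY) : 0 < invExponentBound d c A CX CY := by
  have hd0 : (0 : ℝ) < d := by exact_mod_cast hd
  have hL := (baseL_facts hd hc hc1 A).1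
  have hL0 : 0 < baseL d c A := by linarith
  have hlog : 0 < Real.log (baseL d c A) := Real.log_pos (by linarith)
  have hL3 : 0 < baseL d c A ^ (2 / 3 : ℝ) := Real.rpow_pos_of_pos hL0 _
  rw [invExponentBound]
  positivity

/-- The loss per step of Dolgopyat's method, divided by the logarithm of the ratio of consecutive
scales, beats the exponent of the theorem. -/
lemma log_div_invExponentBound_le {d : ℕ} {c A CX CY : ℝ} (hd : 1 ≤ d) (hc : 0 < c) (hc1 : c ≤ 1)
    (hCX : 1 ≤ CX) (hCY : 1 ≤ CY) {N : ℕ}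
    (hN : N = ⌈Real.logb 2 (20 * baseL d c A ^ (5 / 3 : ℝ))⌉₊) :
    2 * (1 / invExponentBound d c A CX CY) * Real.log (baseL d c A) ≤
      (CX ^ N)⁻¹ * (CY ^ N)⁻¹ * (c / (12000 * max 1 A)) ^ 2 := by
  have hd1 : (1 : ℝ) ≤ d := by exact_mod_cast hd
  have hb := invExponentBound_pos (A := A) hd hc hc1 (by linarith : 0 < CX) (by linarith : 0 < CY)
  obtain ⟨hL, -, ha, -, -⟩ := baseL_facts hd hc hc1 A
  have hlog : 0 < Real.log (baseL d c A) := Real.log_pos (by linarith)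
  have ha1 : 1 ≤ max 1 A := le_max_left _ _
  have ha0 : 0 < max 1 A := by linarith
  have hXY : 1 ≤ CX * CY := one_le_mul_of_one_le_of_one_le hCX hCY
  have hXY0 : 0 < CX * CY := by linarith
  rw [mul_one_div, div_mul_eq_mul_div, div_le_iff₀ hb, invExponentBound, ← hN]
  have hpow : (CX * CY) ^ N ≤ (CX * CY) ^ (4 * N) := pow_le_pow_right₀ hXY (by omega)
  have hd2 : (1 : ℝ) ≤ (d : ℝ) ^ 2 := one_le_pow₀ hd1
  have e : (CX ^ N)⁻¹ * (CY ^ N)⁻¹ * (c / (12000 * max 1 A)) ^ 2 =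
      c ^ 2 / (144000000 * max 1 A ^ 2 * (CX * CY) ^ N) := by
    rw [mul_pow]; field_simp; norm_num
  rw [e, div_mul_eq_mul_div, le_div_iff₀ (by positivity)]
  calc 2 * Real.log (baseL d c A) * (144000000 * max 1 A ^ 2 * (CX * CY) ^ N)
      ≤ 6 * 10 ^ 9 * Real.log (baseL d c A) *
        (1 * baseL d c A ^ (2 / 3 : ℝ) * (CX * CY) ^ (4 * N)) := by
        have h1 : max 1 A ^ 2 * (CX * CY) ^ N ≤
            baseL d c A ^ (2 / 3 : ℝ) * (CX * CY) ^ (4 * N) :=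
          mul_le_mul ha hpow (by positivity) ((sq_nonneg _).trans ha)
        have h2 : 0 ≤ baseL d c A ^ (2 / 3 : ℝ) * (CX * CY) ^ (4 * N) :=
          le_trans (by positivity) h1
        have h3 := mul_le_mul_of_nonneg_left h1 hlog.le
        have h4 := mul_nonneg hlog.le h2
        linarith
    _ ≤ 6 * 10 ^ 9 * Real.log (baseL d c A) *
        ((d : ℝ) ^ 2 * baseL d c A ^ (2 / 3 : ℝ) * (CX * CY) ^ (4 * N)) := by
        have h2 : 0 ≤ baseL d c A ^ (2 / 3 : ℝ) := (sq_nonneg _).trans ha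
        gcongr
    _ = _ := by field_simp

/-- `m` steps of rate `1 - η` amount to a power of `h` when `h` is at least `L ^ (-(m + 3))`. -/
lemma one_sub_pow_le {L h η ε : ℝ} {m : ℕ} (hL : 1 < L) (hh : 0 < h) (hη : η ≤ 1)
    (hε : 0 ≤ ε) (hεη : 2 * ε * Real.log L ≤ η) (hm : 1 < h * L ^ (m + 3)) :
    (1 - η) ^ m ≤ (L ^ (3 * ε) * h ^ ε) ^ 2 := by
  have hL0 : 0 < L := by linarith
  have hlogL : 0 < Real.log L := Real.log_pos hL
  have h1 : (1 - η) ^ m ≤ Real.exp (-η * m) := by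
    have := pow_le_pow_left₀ (sub_nonneg.2 hη) (Real.one_sub_le_exp_neg η) m
    rwa [← Real.exp_nat_mul, mul_comm] at this
  refine h1.trans ?_
  rw [Real.rpow_def_of_pos hL0, Real.rpow_def_of_pos hh, ← Real.exp_add, ← Real.exp_nat_mul,
    Real.exp_le_exp]
  have h2 := Real.log_pos hm
  rw [Real.log_mul hh.ne' (pow_pos hL0 _).ne', Real.log_pow] at h2
  push_cast at h2 ⊢
  have h3 := mul_le_mul_of_nonneg_right hεη (Nat.cast_nonneg (α := ℝ) m)
  have h4 := mul_le_mul_of_nonneg_left h2.le hε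
  nlinarith

end

theorem theorem1p3 (d : ℕ) (hd : 1 ≤ d) (c A CX CY : ℝ)
    (hc : 0 < c) (hc1 : c ≤ 1) (hCX : 0 < CX) (hCY : 0 < CY) :
    ∃ ε₀ : ℝ, 0 < ε₀ ∧ 1 / ε₀ ≤ invExponentBound d c A CX CY ∧
      ∃ C : ℝ, 0 < C ∧
        ∀ (a b : Euc d) (Φ : Euc d × Euc d → ℝ) (p : Euc d × Euc d → ℂ)
          (h : ℝ) (μX μY : Measure (Euc d)) [IsProbabilityMeasure μX] [IsProbabilityMeasure μY],
          ContDiffOn ℝ 3 Φ (unitBox a ×ˢ unitBox b) →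
          c1Norm (unitBox a ×ˢ unitBox b) (mixedHessian (unitBox a ×ˢ unitBox b) Φ) ≤ A →
          ContDiffOn ℝ 1 p (unitBox a ×ˢ unitBox b) →
          0 < h → h ≤ 1 →
          μX.support ⊆ unitBox a → μY.support ⊆ unitBox b →
          IsDoubling μX h CX → IsDoubling μY h CY →
          IsNonorthogonal Φ μX.support μY.support c h h 1 1 →
          ∃ B : Lp ℂ 2 μY →L[ℂ] Lp ℂ 2 μX,
            (∀ f : Lp ℂ 2 μY, B f =ᵐ[μX] semiclassicalFIO Φ p h μY f) ∧
            ‖B‖ ≤ C * c1Norm (unitBox a ×ˢ unitBox b) p * h ^ ε₀ := by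
  have hbpos := invExponentBound_pos (A := A) hd hc hc1 hCX hCY
  obtain ⟨hL, hdL, -, hN1, hN2⟩ := baseL_facts hd hc hc1 A
  have hL0 : 0 < baseL d c A := by linarith
  have hε : 0 < 1 / invExponentBound d c A CX CY := one_div_pos.2 hbpos
  refine ⟨1 / invExponentBound d c A CX CY, hε, by rw [one_div_one_div],
    baseL d c A ^ (3 * (1 / invExponentBound d c A CX CY)), Real.rpow_pos_of_pos hL0 _, ?_⟩
  intro a b Φ p h μX μY _ _ hΦ hA hp hh0 hh1 hXU hYV hDX hDY hN
  have hUk := isCompact_unitBox a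
  have hVk := isCompact_unitBox b
  have hUd := uniqueDiffOn_unitBox a
  have hVd := uniqueDiffOn_unitBox b
  have hP0 := c1Norm_nonneg (unitBox a ×ˢ unitBox b) p
  have hP : ∀ x ∈ unitBox a, ∀ y ∈ unitBox b, ‖p (x, y)‖ ≤ c1Norm (unitBox a ×ˢ unitBox b) p :=
    fun x hx y hy => norm_le_c1Norm hUk hVk hp ⟨hx, hy⟩
  have hP' : ∀ x ∈ unitBox a, ∀ x' ∈ unitBox a, ∀ y ∈ unitBox b,
      ‖p (x, y) - p (x', y)‖ ≤ c1Norm (unitBox a ×ˢ unitBox b) p * dist x x' :=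
    fun x hx x' hx' y hy =>
      norm_sub_le_c1Norm hUk hVk (convex_unitBox a) hUd hVd hp hx hx' hy
  have hA' : ∀ z ∈ unitBox a ×ˢ unitBox b,
      ‖mixedHessian (unitBox a ×ˢ unitBox b) Φ z‖ ≤ max 1 A := fun z hz =>
    ((norm_le_c0Norm (hUk.prod hVk) (continuousOn_mixedHessian hUd hVd hΦ) hz).trans
      (le_add_of_nonneg_right (c0Norm_nonneg _ _))).trans (hA.trans (le_max_right _ _))
  set P := c1Norm (unitBox a ×ˢ unitBox b) p with hPdef
  set L := baseL d c A with hLdef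
  set ε := 1 / invExponentBound d c A CX CY with hεdef
  have hM0 : 0 ≤ L ^ (3 * ε) * P * h ^ ε :=
    mul_nonneg (mul_nonneg (Real.rpow_nonneg hL0.le _) hP0) (Real.rpow_nonneg hh0.le _)
  refine exists_clm_of_integral_norm_sq_le hXU hYV hUk.measurableSet hVk.measurableSet
    hΦ.continuousOn hp.continuousOn hP hM0 fun f hf => ?_
  have hint : ∀ x ∈ μX.support, Integrable (oscIntegrand Φ p h f x) μY := fun x hx =>
    integrable_oscIntegrand hYV hVk.measurableSet hΦ.continuousOn hp.continuousOn hP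
      (hf.integrable one_le_two) (hXU hx)
  have hint2 : Integrable (fun x => ‖∫ z, oscIntegrand Φ p h f x z ∂μY‖ ^ 2) μX :=
    (memLp_integral_oscIntegrand hXU hYV hUk.measurableSet hVk.measurableSet hΦ.continuousOn
      hp.continuousOn hP (hf.integrable one_le_two)).integrable_norm_pow two_ne_zero
  have hf0 : 0 ≤ ∫ y, ‖f y‖ ^ 2 ∂μY := integral_nonneg fun _ => sq_nonneg _
  -- It remains to compare a decay rate, `1` for large `h`, with a power of `h`.
  suffices ∃ r : ℝ, r ≤ (L ^ (3 * ε) * h ^ ε) ^ 2 ∧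
      ∫ x, ‖∫ z, oscIntegrand Φ p h f x z ∂μY‖ ^ 2 ∂μX ≤ r * (P ^ 2 * ∫ y, ‖f y‖ ^ 2 ∂μY) by
    obtain ⟨r, hr, hle⟩ := this
    refine hle.trans ((mul_le_mul_of_nonneg_right hr (by positivity)).trans (le_of_eq ?_))
    ring
  by_cases hsmall : h * L ^ 2 ≤ 1
  · have hhalf : h ≤ 1 / 2 := by nlinarith
    have hCX1 := hDX.one_le hh0 hhalf
    have hCY1 := hDY.one_le hh0 hhalf
    obtain ⟨m, hm1, hm2⟩ : ∃ m : ℕ, h * L ^ (m + 2) ≤ 1 ∧ 1 < h * L ^ (m + 3) := by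
      obtain ⟨m, h1, h2⟩ := exists_nat_pow_near
        (x := 1 / (h * L ^ 2)) (y := L) (by rwa [le_div_iff₀ (by positivity), one_mul])
        (by linarith)
      refine ⟨m, ?_, ?_⟩
      · rw [le_div_iff₀ (by positivity)] at h1
        calc h * L ^ (m + 2) = L ^ m * (h * L ^ 2) := by ring
          _ ≤ 1 := h1
      · rw [div_lt_iff₀ (by positivity)] at h2
        calc 1 < L ^ (m + 1) * (h * L ^ 2) := h2
          _ = h * L ^ (m + 3) := by ring
    have K := stepConstants_baseL (A := A) hd hc hc1
    refine ⟨_, one_sub_pow_le (by linarith) hh0 ?_ hε.le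
      (log_div_invExponentBound_le hd hc hc1 hCX1 hCY1 rfl) hm2,
      integral_norm_sq_oscIntegral_le hd K ?_ hN hDX hDY hCY1 (hUk.totallyBounded.subset hXU)
        (hVk.totallyBounded.subset hYV) hint hint2 (fun x hx y hy => hP x (hXU hx) y (hYV hy))
        (fun x hx x' hx' y hy => hP' x (hXU hx) x' (hXU hx') y (hYV hy)) hf hP0 hh0 hm1 hN1 hN2
        hdL⟩
    · have h5 := inv_le_one_of_one_le₀ (one_le_pow₀ hCX1
        (n := ⌈Real.logb 2 (20 * L ^ (5 / 3 : ℝ))⌉₊))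
      have h6 := inv_le_one_of_one_le₀ (one_le_pow₀ hCY1
        (n := ⌈Real.logb 2 (20 * L ^ (5 / 3 : ℝ))⌉₊))
      have h7 := pow_le_one₀ (n := 2) K.nonneg_τ (by linarith [K.τ_le])
      exact mul_le_one₀ (mul_le_one₀ h5 (by positivity) h6) (by positivity) h7
    · exact fun x hx x' hx' y hy y' hy' => abs_mixed_difference_le (convex_unitBox a)
        (convex_unitBox b) hUd hVd hΦ hA' (hXU hx) (hXU hx') (hYV hy) (hYV hy')
  · refine ⟨1, ?_, ?_⟩
    · have hlarge : 1 ≤ L ^ 3 * h := by nlinarith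
      have e : L ^ (3 * ε) * h ^ ε = (L ^ 3 * h) ^ ε := by
        rw [Real.mul_rpow (by positivity) hh0.le, ← Real.rpow_natCast, ← Real.rpow_mul hL0.le]
        norm_num
      rw [e]
      exact one_le_pow₀ (Real.one_le_rpow hlarge hε.le)
    · rw [one_mul]
      exact integral_norm_sq_le_of_bound hXU hYV hP hf hint2
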